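/- A probabilistic basic parallel process (pBPP) consists of a finite set $\Gamma$ of types, a finite set of rules $X \hookrightarrow \beta$ with $X\in\Gamma$ and $\beta\in\mathbb{N}^\Gamma$, and for each rule a probability $p\in(0,1]\cap\mathbb{Q}$, written $X\overset{p}{\hookrightarrow}\beta$, such that for every $X\in\Gamma$ the probabilities of the rules with left-hand side $X$ sum to $1$ (in particular every type has a rule). A configuration is an element of $\mathbb{N}^\Gamma$; configurations are ordered and added componentwise, and $X$ also denotes the configuration with exactly one process, of type $X$. The pBPP induces two Markov chains on $\mathbb{N}^\Gamma$. In both, the empty configuration $0$ moves to itself with probability $1$. For $\alpha\neq 0$ the transition probabilities are $$\delta_{\mathrm{type}}(\alpha,\gamma)=\sum_{\substack{X\overset{p}{\hookrightarrow}\beta,\ \alpha(X)\ge 1\\ \gamma=\alpha-X+\beta}}\frac{p}{|\{Y\in\Gamma:\alpha(Y)\ge1\}|},\qquad \delta_{\mathrm{proc}}(\alpha,\gamma)=\sum_{\substack{X\overset{p}{\hookrightarrow}\beta,\ \alpha(X)\ge 1\\ \gamma=\alpha-X+\beta}}\frac{\alpha(X)\,p}{\sum_{Y\in\Gamma}\alpha(Y)}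 .$$ For $F\subseteq\mathbb{N}^\Gamma$ write $\mathbb{P}_{\mathrm{type}}(\alpha_0\models\Diamond F)$ and $\mathbb{P}_{\mathrm{proc}}(\alpha_0\models\Diamond F)$ for the probability that the respective chain, started in $\alpha_0$, visits $F$ at some time $i\ge 0$. **Theorem.** Each of the following two problems is decidable. Given a pBPP (with types $\Gamma=\{0,\dots,n-1\}$, by its finite list of rules with their rational probabilities), an upward-closed set $F\subseteq\mathbb{N}^\Gamma$ (given by finitely many configurations $\phi_1,\dots,\phi_k$, $k\ge0$, with $F=\{\beta : \beta\ge\phi_i \text{ for some } i\}$), and an initial configuration $\alpha_0\in\mathbb{N}^\Gamma$, decide 1. whether $\mathbb{P}_{\mathrm{type}}(\alpha_0\models\Diamond F)=1$; 2. whether $\mathbb{P}_{\mathrm{proc}}(\alpha_0\models\Diamond F)=1$. That is, for each of the two problems there is a single computable function which on every such input returns the correct answer. -/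

import Mathlib

open MeasureTheory ProbabilityTheory

/-- A Markov chain on a (countable) state space `Q`: a probability distribution over the
successor states for every state. -/
structure MarkovChain (Q : Type*) where
  δ : Q → PMF Q

namespace MarkovChain

variable {Q : Type*} [Countable Q] [MeasurableSpace Q] [DiscreteMeasurableSpace Q]

/-- The kernel that draws the next state from `δ` applied to the last state `h k` of the history
`h = (h 0, …, h k)`. -/
noncomputable def stepKernel (M : MarkovChain Q) (k : ℕ) :
    Kernel ((i : Finset.Iic k) → Q) Q where
  toFun h := (M.δ (h ⟨k, Finset.mem_Iic.2 le_rfl⟩)).toMeasure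
  measurable' :=
    (Measurable.of_discrete (f := fun q : Q => (M.δ q).toMeasure)).comp
      (measurable_pi_apply (⟨k, Finset.mem_Iic.2 le_rfl⟩ : Finset.Iic k))

instance (M : MarkovChain Q) (k : ℕ) : IsMarkovKernel (M.stepKernel k) where
  isProbabilityMeasure _ := PMF.toMeasure.isProbabilityMeasure _

/-- The law of the infinite trajectory `s₀ s₁ s₂ …` of the chain `M` started in the state `s₀`,
on the product σ-algebra, which is generated by the cylinders. Sequences that take a step of
probability zero form a null set. -/
noncomputable def trajLaw (M : MarkovChain Q) (s₀ : Q) : Measure (ℕ → Q) :=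
  Kernel.trajMeasure (X := fun _ : ℕ => Q) (Measure.dirac s₀) M.stepKernel

/-- The probability `P(s₀ ⊨ ◇F)` that the chain started in `s₀` visits `F` at some time `i ≥ 0`. -/
noncomputable def probReach (M : MarkovChain Q) (s₀ : Q) (F : Set Q) : ENNReal :=
  M.trajLaw s₀ {ω | ∃ i, ω i ∈ F}

end MarkovChain

/-- A probabilistic basic parallel process over the finite set `Γ` of types. A rule `(X, β)` replaces
a process of type `X` by the processes in the configuration `β : Γ → ℕ`. The values of `prob`
outside `rules` play no role. That every type has a rule, and that probabilities are at most one,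
follows from `sum_prob` and `prob_pos`. -/
structure PBPP (Γ : Type*) [Fintype Γ] [DecidableEq Γ] where
  rules : Finset (Γ × (Γ → ℕ))
  prob : Γ × (Γ → ℕ) → ℚ
  prob_pos : ∀ r ∈ rules, 0 < prob r
  sum_prob : ∀ X : Γ, ∑ r ∈ rules with r.1 = X, prob r = 1

namespace PBPP

variable {Γ : Type*} [Fintype Γ] [DecidableEq Γ]

/-- The number of types that are present in a configuration. -/
def numTypes (α : Γ → ℕ) : ℕ := (Finset.univ.filter fun X => 1 ≤ α X).card

/-- The number of processes in a configuration. -/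
def numProcs (α : Γ → ℕ) : ℕ := ∑ X, α X

/-- The configuration obtained from `α` by applying the rule `r = (X, β)`, that is, `α - X + β`;
meaningful if `1 ≤ α X`. -/
def applyRule (α : Γ → ℕ) (r : Γ × (Γ → ℕ)) : Γ → ℕ := α - Pi.single r.1 1 + r.2

/-- Transition probabilities, when a present type is scheduled uniformly at random. -/
def stepType (S : PBPP Γ) (α γ : Γ → ℕ) : ℚ :=
  if α = 0 then (if γ = 0 then 1 else 0)
  else ∑ r ∈ S.rules with 1 ≤ α r.1 ∧ γ = applyRule α r, S.prob r / numTypes α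

/-- Transition probabilities, when a present process is scheduled uniformly at random.
Rules whose type is absent contribute zero. -/
def stepProc (S : PBPP Γ) (α γ : Γ → ℕ) : ℚ :=
  if α = 0 then (if γ = 0 then 1 else 0)
  else ∑ r ∈ S.rules with γ = applyRule α r, α r.1 * S.prob r / numProcs α

set_option linter.unusedSectionVars false

theorem hasSum_fiber (R : Finset (Γ × (Γ → ℕ))) (w : Γ × (Γ → ℕ) → ℚ) (hw : ∀ r ∈ R, 0 ≤ w r)
    (g : Γ × (Γ → ℕ) → Γ → ℕ) (h1 : ∑ r ∈ R, w r = 1) :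
    HasSum (fun γ => ENNReal.ofReal ((∑ r ∈ R with γ = g r, w r : ℚ) : ℝ)) 1 := by
  have e : ∀ γ : Γ → ℕ, ENNReal.ofReal ((∑ r ∈ R with γ = g r, w r : ℚ) : ℝ)
      = ∑ r ∈ R, if γ = g r then ENNReal.ofReal (w r : ℝ) else 0 := by
    intro γ
    rw [Rat.cast_sum, ENNReal.ofReal_sum_of_nonneg, Finset.sum_filter]
    intro r hr
    exact_mod_cast hw r (Finset.mem_filter.1 hr).1
  have h2 : ∑ r ∈ R, ENNReal.ofReal (w r : ℝ) = 1 := by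
    rw [← ENNReal.ofReal_sum_of_nonneg (fun r hr => by exact_mod_cast hw r hr), ← Rat.cast_sum, h1]
    simp
  simp_rw [e]
  rw [← h2]
  exact hasSum_sum fun r _ => hasSum_ite_eq (g r) _

theorem hasSum_zero :
    HasSum (fun γ : Γ → ℕ => ENNReal.ofReal (((if γ = 0 then 1 else 0 : ℚ)) : ℝ)) 1 := by
  have : (fun γ : Γ → ℕ => ENNReal.ofReal (((if γ = 0 then 1 else 0 : ℚ)) : ℝ))
      = fun γ => if γ = 0 then 1 else 0 := by
    funext γ
    split_ifs <;> simp
  rw [this]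
  exact hasSum_ite_eq 0 1

theorem sum_rules (S : PBPP Γ) (c : Γ → ℚ) :
    ∑ r ∈ S.rules, c r.1 * S.prob r = ∑ X, c X := by
  rw [← Finset.sum_fiberwise S.rules (fun r => r.1)]
  refine Finset.sum_congr rfl fun X _ => ?_
  rw [Finset.sum_congr rfl (g := fun r => c X * S.prob r)
    (fun r hr => by rw [(Finset.mem_filter.1 hr).2]), ← Finset.mul_sum, S.sum_prob, mul_one]

theorem hasSum_stepType (S : PBPP Γ) (α : Γ → ℕ) :
    HasSum (fun γ => ENNReal.ofReal (S.stepType α γ : ℝ)) 1 := by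
  unfold stepType
  by_cases hα : α = 0
  · simpa only [hα, if_true] using hasSum_zero
  · simp only [hα, if_false, ← Finset.filter_filter]
    apply hasSum_fiber
    · intro r hr
      exact div_nonneg (S.prob_pos r (Finset.mem_filter.1 hr).1).le (Nat.cast_nonneg _)
    · have h := S.sum_rules (fun X => if 1 ≤ α X then (1 : ℚ) else 0)
      simp only [ite_mul, one_mul, zero_mul, ← Finset.sum_filter] at h
      rw [← Finset.sum_div, h]
      have hn : (numTypes α : ℚ) ≠ 0 := by
        obtain ⟨X, hX⟩ := Function.ne_iff.1 hα
        have : numTypes α ≠ 0 := Finset.card_ne_zero.2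
          ⟨X, Finset.mem_filter.2 ⟨Finset.mem_univ _, Nat.one_le_iff_ne_zero.2 hX⟩⟩
        exact_mod_cast this
      simpa [numTypes] using div_self hn

theorem hasSum_stepProc (S : PBPP Γ) (α : Γ → ℕ) :
    HasSum (fun γ => ENNReal.ofReal (S.stepProc α γ : ℝ)) 1 := by
  unfold stepProc
  by_cases hα : α = 0
  · simpa only [hα, if_true] using hasSum_zero
  · simp only [hα, if_false]
    apply hasSum_fiber
    · intro r hr
      exact div_nonneg (mul_nonneg (Nat.cast_nonneg _) (S.prob_pos r hr).le) (Nat.cast_nonneg _)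
    · rw [← Finset.sum_div, S.sum_rules (fun X => (α X : ℚ)), ← Nat.cast_sum]
      have hn : numProcs α ≠ 0 := by
        obtain ⟨X, hX⟩ := Function.ne_iff.1 hα
        intro h
        exact hX (Finset.sum_eq_zero_iff.1 h X (Finset.mem_univ _))
      exact div_self (Nat.cast_ne_zero.2 hn)

/-- The Markov chain on configurations in which the type to be scheduled is chosen uniformly
among the types that are present. -/
noncomputable def chainType (S : PBPP Γ) : MarkovChain (Γ → ℕ) where
  δ α := ⟨fun γ => ENNReal.ofReal (S.stepType α γ : ℝ), S.hasSum_stepType α⟩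

/-- The Markov chain on configurations in which the process to be scheduled is chosen uniformly
among the processes that are present. -/
noncomputable def chainProc (S : PBPP Γ) : MarkovChain (Γ → ℕ) where
  δ α := ⟨fun γ => ENNReal.ofReal (S.stepProc α γ : ℝ), S.hasSum_stepProc α⟩

/-- Inputs of a decision procedure: the number of types; the list of rules (type, right-hand side,
numerator and denominator of the probability); the list of the configurations that generate the
target set; the initial configuration. A configuration is the list of its entries. -/
abbrev Input : Type :=
  ℕ × List (ℕ × List ℕ × ℕ × ℕ) × List (List ℕ) × List ℕ

/-- The input that presents the pBPP `S` with types `0, …, n - 1`, its rules being listed in `L`,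
the target configurations `φs` and the initial configuration `α₀`. -/
def encodeInput {n : ℕ} (S : PBPP (Fin n)) (L : List (Fin n × (Fin n → ℕ)))
    (φs : List (Fin n → ℕ)) (α₀ : Fin n → ℕ) : Input :=
  (n, L.map (fun r => ((r.1 : ℕ), List.ofFn r.2, (S.prob r).num.natAbs, (S.prob r).den)),
    φs.map List.ofFn, List.ofFn α₀)

end PBPP

/-! Under both schedulers, `F` is reached almost surely if and only if no path that stays outside
`F` leads to a configuration from which `F` is unreachable, that is, if and only if `CanEscape`
fails. This condition mentions neither probabilities nor the scheduler, so one algorithm decides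
both problems.

If escape is possible, a finite path of positive probability leads to a configuration where
avoidance is certain (`exists_le_avoid_of_canEscape`). For the converse, the configurations that can
reach `F` form an upward-closed set, which has a finite basis by Dickson's lemma. Hence it suffices
to bound the probability of reaching `F` from below uniformly above each basis element
(`exists_avoidLim_le`). Such bounds are pulled back along a path, one rule at a time (`PullsBack`).
For types this is immediate, since an enabled rule has probability at least `p / |Γ|`. For processes
the rule may become arbitrarily unlikely in large configurations, but the population grows at most
linearly in time. By divergence of the harmonic series, the processes that form the small
configuration are not ignored forever (`pullsBack_weightProc`). If escape is impossible, a run that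
has not yet met `F` always retains a chance of at least `c` to meet it, so the probability `a` of
avoiding `F` forever satisfies `a ≤ a * (1 - c)` and vanishes (`avoidLim_eq_zero`).

For decidability, the configurations that cannot escape are upward closed too (`CanEscape.anti`).
Finite bases and finite paths therefore yield finite certificates both for escape and for its
impossibility, checkable by a primitive recursive test. Searching for both kinds at once terminates.
-/

theorem IsUpperSet.exists_finite_basis {M : Type*} [PartialOrder M] [WellQuasiOrderedLE M]
    {s : Set M} (hs : IsUpperSet s) :
    ∃ t : Set M, t.Finite ∧ t ⊆ s ∧ ∀ a, a ∈ s ↔ ∃ b ∈ t, b ≤ a := by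
  -- The minimal elements form an antichain, and antichains in a well-quasi-order are finite.
  refine ⟨{b | Minimal (· ∈ s) b}, (setOfPred_minimal_antichain _).finite_of_partiallyWellOrderedOn
    (Set.isPWO_of_wellQuasiOrderedLE _), fun b hb => hb.1, fun a => ⟨fun ha => ?_, ?_⟩⟩
  · obtain ⟨b, hb, hm⟩ := exists_minimal_le_of_wellFoundedLT (· ∈ s) a ha
    exact ⟨b, hm, hb⟩
  · rintro ⟨b, hb, hba⟩
    exact hs hba hb.1

/-! ### Reachability, escape, and their finite certificates -/

namespace PBPP

set_option linter.unusedSectionVars false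

variable {Γ : Type*} [Fintype Γ] [DecidableEq Γ]

/-- Some configuration in `F` is reachable by finitely many rule applications. -/
inductive CanReach (R : Set (Γ × (Γ → ℕ))) (F : Set (Γ → ℕ)) : (Γ → ℕ) → Prop
  | base {α : Γ → ℕ} : α ∈ F → CanReach R F α
  | step {α : Γ → ℕ} {r : Γ × (Γ → ℕ)} :
      r ∈ R → 1 ≤ α r.1 → CanReach R F (applyRule α r) → CanReach R F α

/-- Some configuration from which `F` is unreachable can be reached without visiting `F`. -/
inductive CanEscape (R : Set (Γ × (Γ → ℕ))) (F : Set (Γ → ℕ)) : (Γ → ℕ) → Prop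
  | base {α : Γ → ℕ} : ¬ CanReach R F α → CanEscape R F α
  | step {α : Γ → ℕ} {r : Γ × (Γ → ℕ)} :
      α ∉ F → r ∈ R → 1 ≤ α r.1 → CanEscape R F (applyRule α r) → CanEscape R F α

variable {R : Set (Γ × (Γ → ℕ))} {F : Set (Γ → ℕ)}

theorem applyRule_mono {α α' : Γ → ℕ} (h : α ≤ α') (r : Γ × (Γ → ℕ)) :
    applyRule α r ≤ applyRule α' r := fun X => by
  have := h X
  simp only [applyRule, Pi.add_apply, Pi.sub_apply]
  lia

theorem CanReach.mono (hF : IsUpperSet F) {α α' : Γ → ℕ} (h : CanReach R F α) (hα : α ≤ α') :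
    CanReach R F α' := by
  induction h generalizing α' with
  | base h => exact .base (hF hα h)
  | step hr h1 _ ih => exact .step hr (h1.trans (hα _)) (ih (applyRule_mono hα _))

/-- The escaping path is replayed from the smaller configuration, omitting the rules whose type is
absent there. Omission preserves the domination, because the rule removes only a process that the
smaller configuration lacks. -/
theorem CanEscape.anti (hF : IsUpperSet F) {α α' : Γ → ℕ} (h : CanEscape R F α) (hα : α' ≤ α) :
    CanEscape R F α' := by
  induction h generalizing α' with
  | base h => exact .base fun h' => h (h'.mono hF hα)
  | @step α r hF' hr h1 _ ih =>
    by_cases h : 1 ≤ α' r.1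
    · exact .step (fun h' => hF' (hF hα h')) hr h (ih (applyRule_mono hα _))
    · refine ih fun X => ?_
      have := hα X
      simp only [applyRule, Pi.add_apply, Pi.sub_apply, Pi.single_apply]
      split_ifs with hX
      · subst hX; lia
      · lia

theorem canReach_of_not_canEscape {α : Γ → ℕ} (h : ¬ CanEscape R F α) : CanReach R F α :=
  by_contra fun h' => h (.base h')

theorem exists_basis_canReach (hF : IsUpperSet F) :
    ∃ K : Set (Γ → ℕ), K.Finite ∧ ∀ α, CanReach R F α ↔ ∃ κ ∈ K, κ ≤ α := by
  obtain ⟨K, hK, -, h⟩ := IsUpperSet.exists_finite_basis (s := {α | CanReach R F α})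
    fun _ _ h h' => CanReach.mono hF h' h
  exact ⟨K, hK, h⟩

/-- A set of ranked configurations whose upward closure witnesses that `α` cannot escape: outside
of `F` it is closed under rules, and from each of its members `F` is reached by decreasing ranks. -/
structure IsReachCert (R : Set (Γ × (Γ → ℕ))) (F : Set (Γ → ℕ)) (C : Set ((Γ → ℕ) × ℕ))
    (α : Γ → ℕ) : Prop where
  init : ∃ g ∈ C, g.1 ≤ α
  closed : ∀ g ∈ C, ∀ r ∈ R, g.1 ⊔ Pi.single r.1 1 ∈ F ∨
    ∃ g' ∈ C, g'.1 ≤ applyRule (g.1 ⊔ Pi.single r.1 1) r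
  rank : ∀ g ∈ C, g.1 ∈ F ∨
    ∃ r ∈ R, 1 ≤ g.1 r.1 ∧ ∃ g' ∈ C, g'.2 < g.2 ∧ g'.1 ≤ applyRule g.1 r

/-- A set `C` of ranked configurations and a set `K` witnessing that `α` can escape: the upward
closure of `K` contains `F` and is closed under predecessors, and `C` traces a path outside of `F`
that leaves this upward closure. -/
structure IsEscapeCert (R : Set (Γ × (Γ → ℕ))) (F : Set (Γ → ℕ)) (C : Set ((Γ → ℕ) × ℕ))
    (K : Set (Γ → ℕ)) (α : Γ → ℕ) : Prop where
  init : ∃ g ∈ C, α ≤ g.1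
  rank : ∀ g ∈ C, g.1 ∉ F ∧ ((¬ ∃ κ ∈ K, κ ≤ g.1) ∨
    ∃ r ∈ R, 1 ≤ g.1 r.1 ∧ ∃ g' ∈ C, g'.2 < g.2 ∧ applyRule g.1 r ≤ g'.1)
  target : ∀ φ ∈ F, ∃ κ ∈ K, κ ≤ φ
  pre : ∀ κ ∈ K, ∀ r ∈ R, ∃ κ' ∈ K, κ' ≤ κ - r.2 + Pi.single r.1 1

theorem isReachCert_iff {C : Set ((Γ → ℕ) × ℕ)} {α : Γ → ℕ} : IsReachCert R F C α ↔
    (∃ g ∈ C, g.1 ≤ α) ∧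
    (∀ g ∈ C, ∀ r ∈ R, g.1 ⊔ Pi.single r.1 1 ∈ F ∨
      ∃ g' ∈ C, g'.1 ≤ applyRule (g.1 ⊔ Pi.single r.1 1) r) ∧
    ∀ g ∈ C, g.1 ∈ F ∨ ∃ r ∈ R, 1 ≤ g.1 r.1 ∧ ∃ g' ∈ C, g'.2 < g.2 ∧ g'.1 ≤ applyRule g.1 r :=
  ⟨fun ⟨h1, h2, h3⟩ => ⟨h1, h2, h3⟩, fun ⟨h1, h2, h3⟩ => ⟨h1, h2, h3⟩⟩

theorem isEscapeCert_iff {C : Set ((Γ → ℕ) × ℕ)} {K : Set (Γ → ℕ)} {α : Γ → ℕ} :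
    IsEscapeCert R F C K α ↔
    (∃ g ∈ C, α ≤ g.1) ∧
    (∀ g ∈ C, g.1 ∉ F ∧ ((¬ ∃ κ ∈ K, κ ≤ g.1) ∨
      ∃ r ∈ R, 1 ≤ g.1 r.1 ∧ ∃ g' ∈ C, g'.2 < g.2 ∧ applyRule g.1 r ≤ g'.1)) ∧
    (∀ φ ∈ F, ∃ κ ∈ K, κ ≤ φ) ∧
    ∀ κ ∈ K, ∀ r ∈ R, ∃ κ' ∈ K, κ' ≤ κ - r.2 + Pi.single r.1 1 :=
  ⟨fun ⟨h1, h2, h3, h4⟩ => ⟨h1, h2, h3, h4⟩, fun ⟨h1, h2, h3, h4⟩ => ⟨h1, h2, h3, h4⟩⟩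

/-- By induction on ranks every member of `C` can reach `F`, and the upward closure of `C` is an
invariant of paths outside `F`. An escaping path would thus end where `F` is still reachable. -/
theorem IsReachCert.not_canEscape (hF : IsUpperSet F) {C : Set ((Γ → ℕ) × ℕ)} {α : Γ → ℕ}
    (h : IsReachCert R F C α) : ¬ CanEscape R F α := by
  have reach : ∀ k, ∀ g ∈ C, g.2 = k → CanReach R F g.1 := by
    intro k
    induction k using Nat.strong_induction_on with
    | _ k ih =>
      rintro g hg rfl
      obtain h' | ⟨r, hr, h1, g', hg', hlt, hle⟩ := h.rank g hg
      · exact .base h'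
      · exact .step hr h1 ((ih _ hlt g' hg' rfl).mono hF hle)
  intro hesc
  have hi := h.init
  induction hesc with
  | base h' =>
    obtain ⟨g, hg, hle⟩ := hi
    exact h' ((reach _ g hg rfl).mono hF hle)
  | @step α r hα hr h1 _ ih =>
    obtain ⟨g, hg, hle⟩ := hi
    -- The join is the least configuration above `g.1` in which `r` is enabled, so checking `r`
    -- there covers every `α` above `g.1`.
    have hsup : g.1 ⊔ Pi.single r.1 1 ≤ α := by
      refine sup_le hle fun X => ?_
      rw [Pi.single_apply]
      split_ifs with hX
      · exact hX ▸ h1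
      · exact Nat.zero_le _
    obtain h' | ⟨g', hg', hle'⟩ := h.closed g hg r hr
    · exact hα (hF hsup h')
    · have hi' : ∃ g ∈ C, g.1 ≤ applyRule α r := ⟨g', hg', hle'.trans (applyRule_mono hsup r)⟩
      exact ih ⟨hi', h.closed, h.rank⟩ hi'

/-- Ranks count the steps that remain on a path to `F`. The path is cut at its first visit to `F`,
since the impossibility of escape passes to successors only outside `F`. -/
theorem exists_ranked_of_canReach {α : Γ → ℕ} (h : CanReach R F α) (hα : ¬ CanEscape R F α) :
    ∃ C : Set ((Γ → ℕ) × ℕ), C.Finite ∧ (∃ g ∈ C, g.1 = α) ∧ (∀ g ∈ C, ¬ CanEscape R F g.1) ∧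
      ∀ g ∈ C, g.1 ∈ F ∨
        ∃ r ∈ R, 1 ≤ g.1 r.1 ∧ ∃ g' ∈ C, g'.2 < g.2 ∧ g'.1 ≤ applyRule g.1 r := by
  induction h with
  | @base α h =>
    exact ⟨{(α, 0)}, Set.finite_singleton _, by simp, by simpa using hα, by simp [h]⟩
  | @step α r hr h1 _ ih =>
    by_cases hαF : α ∈ F
    · exact ⟨{(α, 0)}, Set.finite_singleton _, by simp, by simpa using hα, by simp [hαF]⟩
    obtain ⟨C, hC, ⟨g, hg, hgα⟩, hne, hrank⟩ := ih fun h => hα (.step hαF hr h1 h)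
    refine ⟨insert (α, g.2 + 1) C, hC.insert _, ⟨_, Set.mem_insert _ _, rfl⟩, ?_, ?_⟩
    · rintro g' (rfl | hg')
      · exact hα
      · exact hne g' hg'
    · rintro g' (rfl | hg')
      · exact .inr ⟨r, hr, h1, g, .inr hg, Nat.lt_succ_self _, hgα.le⟩
      · obtain h | ⟨r', h2, h3, g'', h4, h5⟩ := hrank g' hg'
        · exact .inl h
        · exact .inr ⟨r', h2, h3, g'', .inr h4, h5⟩

theorem exists_isReachCert (hF : IsUpperSet F) {α : Γ → ℕ} (h : ¬ CanEscape R F α) :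
    ∃ C : Set ((Γ → ℕ) × ℕ), C.Finite ∧ IsReachCert R F C α := by
  obtain ⟨K, hK, hKs, hbasis⟩ := IsUpperSet.exists_finite_basis (s := {α | ¬ CanEscape R F α})
    fun _ _ h h' h'' => h' (h''.anti hF h)
  choose! C hfin hmem hne hrank using fun κ (hκ : κ ∈ K) =>
    exists_ranked_of_canReach (canReach_of_not_canEscape (hKs hκ)) (hKs hκ)
  have cover : ∀ β, ¬ CanEscape R F β → ∃ g ∈ ⋃ κ ∈ K, C κ, g.1 ≤ β := by
    intro β hβ
    obtain ⟨κ, hκ, hle⟩ := (hbasis β).1 hβ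
    obtain ⟨g, hg, hgκ⟩ := hmem κ hκ
    exact ⟨g, Set.mem_biUnion hκ hg, hgκ.trans_le hle⟩
  refine ⟨⋃ κ ∈ K, C κ, hK.biUnion hfin, cover α h, ?_, ?_⟩
  · intro g hg r hr
    obtain ⟨κ, hκ, hg⟩ := Set.mem_iUnion₂.1 hg
    -- If the successor could escape, so could the join, and then by `CanEscape.anti` the smaller
    -- `g.1`.
    refine or_iff_not_imp_left.2 fun hF' => cover _ fun hesc => ?_
    refine hne κ hκ g hg (CanEscape.anti hF (.step hF' hr ?_ hesc) le_sup_left)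
    simp
  · intro g hg
    obtain ⟨κ, hκ, hg⟩ := Set.mem_iUnion₂.1 hg
    obtain h | ⟨r', h2, h3, g'', h4, h5⟩ := hrank κ hκ g hg
    · exact .inl h
    · exact .inr ⟨r', h2, h3, g'', Set.mem_biUnion hκ h4, h5⟩

/-- The upward closure of `K` overapproximates the configurations that can reach `F`, so leaving it
proves unreachability. The decreasing ranks make the traced path end there. -/
theorem IsEscapeCert.canEscape (hF : IsUpperSet F) {C : Set ((Γ → ℕ) × ℕ)} {K : Set (Γ → ℕ)}
    {α : Γ → ℕ} (h : IsEscapeCert R F C K α) : CanEscape R F α := by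
  have hK : ∀ β, CanReach R F β → ∃ κ ∈ K, κ ≤ β := by
    intro β hβ
    induction hβ with
    | base h' => exact h.target _ h'
    | @step β r hr h1 _ ih =>
      obtain ⟨κ, hκ, hle⟩ := ih
      obtain ⟨κ', hκ', hle'⟩ := h.pre κ hκ r hr
      refine ⟨κ', hκ', hle'.trans fun X => ?_⟩
      have := hle X
      simp only [applyRule, Pi.add_apply, Pi.sub_apply, Pi.single_apply] at this ⊢
      split_ifs at this ⊢ with hX
      · subst hX; lia
      · lia
  have esc : ∀ k, ∀ g ∈ C, g.2 = k → CanEscape R F g.1 := by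
    intro k
    induction k using Nat.strong_induction_on with
    | _ k ih =>
      rintro g hg rfl
      obtain ⟨hgF, h' | ⟨r, hr, h1, g', hg', hlt, hle⟩⟩ := h.rank g hg
      · exact .base fun h'' => h' (hK _ h'')
      · exact .step hgF hr h1 ((ih _ hlt g' hg' rfl).anti hF hle)
  obtain ⟨g, hg, hle⟩ := h.init
  exact (esc _ g hg rfl).anti hF hle

theorem exists_isEscapeCert (hF : IsUpperSet F) {α : Γ → ℕ} (h : CanEscape R F α) :
    ∃ (C : Set ((Γ → ℕ) × ℕ)) (K : Set (Γ → ℕ)), C.Finite ∧ K.Finite ∧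
      IsEscapeCert R F C K α := by
  obtain ⟨K, hK, hKr⟩ := exists_basis_canReach (R := R) hF
  have path : ∃ C : Set ((Γ → ℕ) × ℕ), C.Finite ∧ (∃ g ∈ C, g.1 = α) ∧
      ∀ g ∈ C, g.1 ∉ F ∧ ((¬ ∃ κ ∈ K, κ ≤ g.1) ∨
        ∃ r ∈ R, 1 ≤ g.1 r.1 ∧ ∃ g' ∈ C, g'.2 < g.2 ∧ applyRule g.1 r ≤ g'.1) := by
    induction h with
    | @base α h =>
      refine ⟨{(α, 0)}, Set.finite_singleton _, by simp, ?_⟩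
      rintro g rfl
      exact ⟨fun h' => h (.base h'), .inl ((hKr α).not.1 h)⟩
    | @step α r hα hr h1 _ ih =>
      obtain ⟨C, hC, ⟨g, hg, hgα⟩, hrank⟩ := ih
      refine ⟨insert (α, g.2 + 1) C, hC.insert _, ⟨_, Set.mem_insert _ _, rfl⟩, ?_⟩
      rintro g' (rfl | hg')
      · exact ⟨hα, .inr ⟨r, hr, h1, g, .inr hg, Nat.lt_succ_self _, hgα.ge⟩⟩
      · obtain ⟨h0, h | ⟨r', h2, h3, g'', h4, h5⟩⟩ := hrank g' hg'
        · exact ⟨h0, .inl h⟩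
        · exact ⟨h0, .inr ⟨r', h2, h3, g'', .inr h4, h5⟩⟩
  obtain ⟨C, hC, ⟨g, hg, hgα⟩, hrank⟩ := path
  refine ⟨C, K, hC, hK, ⟨g, hg, hgα.ge⟩, hrank, fun φ hφ => (hKr φ).1 (.base hφ), ?_⟩
  intro κ hκ r hr
  -- Applying `r` to `κ - r.2 + Pi.single r.1 1` gives `κ - r.2 + r.2`, which lies above `κ` despite
  -- the truncated subtraction.
  refine (hKr _).1 (.step hr (by simp) (((hKr κ).2 ⟨κ, hκ, le_rfl⟩).mono hF fun X => ?_))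
  simp only [applyRule, Pi.add_apply, Pi.sub_apply]
  lia

end PBPP

/-! ### Avoidance probabilities for abstract schedulers -/

namespace PBPP

set_option linter.unusedSectionVars false

variable {Γ : Type*} [Fintype Γ] [DecidableEq Γ]

open Classical in
/-- The probability of avoiding `F` during `T` steps, if a nonempty configuration `α` evolves by the
rule `r` with probability `w α r`. -/
noncomputable def avoid (w : (Γ → ℕ) → Γ × (Γ → ℕ) → ℝ) (R : Finset (Γ × (Γ → ℕ)))
    (F : Set (Γ → ℕ)) : ℕ → (Γ → ℕ) → ℝ
  | 0, α => if α ∈ F then 0 else 1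
  | T + 1, α => if α ∈ F then 0 else if α = 0 then avoid w R F T 0
      else ∑ r ∈ R, w α r * avoid w R F T (applyRule α r)

/-- The weights `w` randomly choose a rule of `R` that is applicable. -/
structure IsScheduler (w : (Γ → ℕ) → Γ × (Γ → ℕ) → ℝ) (R : Finset (Γ × (Γ → ℕ))) : Prop where
  nonneg : ∀ α, ∀ r ∈ R, 0 ≤ w α r
  sum_eq : ∀ α, α ≠ 0 → ∑ r ∈ R, w α r = 1
  pos : ∀ α, ∀ r ∈ R, 1 ≤ α r.1 → 0 < w α r
  zero : ∀ α, ∀ r ∈ R, α r.1 = 0 → w α r = 0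

/-- The probability of avoiding `F` forever. -/
noncomputable def avoidLim (w : (Γ → ℕ) → Γ × (Γ → ℕ) → ℝ) (R : Finset (Γ × (Γ → ℕ)))
    (F : Set (Γ → ℕ)) (α : Γ → ℕ) : ℝ := ⨅ T, avoid w R F T α

variable {w : (Γ → ℕ) → Γ × (Γ → ℕ) → ℝ} {R : Finset (Γ × (Γ → ℕ))} {F : Set (Γ → ℕ)}

theorem avoid_of_mem {α : Γ → ℕ} (h : α ∈ F) (T : ℕ) : avoid w R F T α = 0 := by
  cases T <;> simp [avoid, h]

theorem avoid_zero_of_notMem (h : 0 ∉ F) (T : ℕ) : avoid w R F T 0 = 1 := by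
  induction T with
  | zero => simp [avoid, h]
  | succ T ih => simp [avoid, h, ih]

theorem avoid_succ {α : Γ → ℕ} (h : α ∉ F) (h0 : α ≠ 0) (T : ℕ) :
    avoid w R F (T + 1) α = ∑ r ∈ R, w α r * avoid w R F T (applyRule α r) := by
  simp [avoid, h, h0]

theorem avoid_nonneg (hw : IsScheduler w R) (T : ℕ) (α : Γ → ℕ) : 0 ≤ avoid w R F T α := by
  induction T generalizing α with
  | zero => rw [avoid]; split_ifs <;> simp
  | succ T ih =>
    rw [avoid]
    split_ifs
    · exact le_rfl
    · exact ih 0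
    · exact Finset.sum_nonneg fun r hr => mul_nonneg (hw.nonneg α r hr) (ih _)

theorem avoid_le_one (hw : IsScheduler w R) (T : ℕ) (α : Γ → ℕ) : avoid w R F T α ≤ 1 := by
  induction T generalizing α with
  | zero => rw [avoid]; split_ifs <;> simp
  | succ T ih =>
    rw [avoid]
    split_ifs with h h0
    · exact zero_le_one
    · exact ih 0
    · rw [← hw.sum_eq α h0]
      exact Finset.sum_le_sum fun r hr => mul_le_of_le_one_right (hw.nonneg α r hr) (ih _)

theorem avoid_antitone (hw : IsScheduler w R) (α : Γ → ℕ) :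
    Antitone fun T => avoid w R F T α := by
  refine antitone_nat_of_succ_le fun T => ?_
  induction T generalizing α with
  | zero =>
    by_cases h : α ∈ F
    · simp [avoid_of_mem h]
    · simpa [avoid, h] using avoid_le_one (F := F) hw 1 α
  | succ T ih =>
    by_cases h : α ∈ F
    · simp [avoid_of_mem h]
    by_cases h0 : α = 0
    · subst h0; simp [avoid_zero_of_notMem h]
    rw [avoid_succ h h0, avoid_succ h h0]
    exact Finset.sum_le_sum fun r hr => mul_le_mul_of_nonneg_left (ih _) (hw.nonneg α r hr)

theorem tendsto_avoid (hw : IsScheduler w R) (α : Γ → ℕ) :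
    Filter.Tendsto (fun T => avoid w R F T α) Filter.atTop (nhds (avoidLim w R F α)) :=
  tendsto_atTop_ciInf (avoid_antitone hw α) ⟨0, by rintro _ ⟨T, rfl⟩; exact avoid_nonneg hw T α⟩

theorem avoidLim_nonneg (hw : IsScheduler w R) (α : Γ → ℕ) : 0 ≤ avoidLim w R F α :=
  ge_of_tendsto' (tendsto_avoid hw α) fun T => avoid_nonneg hw T α

theorem avoidLim_le_one (hw : IsScheduler w R) (α : Γ → ℕ) : avoidLim w R F α ≤ 1 :=
  le_of_tendsto' (tendsto_avoid hw α) fun T => avoid_le_one hw T α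

theorem avoidLim_of_mem {α : Γ → ℕ} (h : α ∈ F) : avoidLim w R F α = 0 := by
  simp [avoidLim, avoid_of_mem h]

theorem avoidLim_eq (hw : IsScheduler w R) {α : Γ → ℕ} (h : α ∉ F) (h0 : α ≠ 0) :
    avoidLim w R F α = ∑ r ∈ R, w α r * avoidLim w R F (applyRule α r) := by
  refine tendsto_nhds_unique ((tendsto_avoid hw α).comp (Filter.tendsto_add_atTop_nat 1)) ?_
  simp only [Function.comp_def, avoid_succ h h0]
  exact tendsto_finsetSum _ fun r _ => (tendsto_avoid hw _).const_mul _

/-- Along a single rule application, a bound on the avoidance probability that is uniform above the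
successor of `m` yields one that is uniform above `m`. -/
def PullsBack (w : (Γ → ℕ) → Γ × (Γ → ℕ) → ℝ) (R : Finset (Γ × (Γ → ℕ))) : Prop :=
  ∀ (F : Set (Γ → ℕ)) (m : Γ → ℕ), ∀ r ∈ R, 1 ≤ m r.1 → ∀ c : ℝ, 0 < c →
    (∀ α, applyRule m r ≤ α → avoidLim w R F α ≤ 1 - c) →
    ∃ d : ℝ, 0 < d ∧ ∀ α, m ≤ α → α ∉ F → avoidLim w R F α ≤ 1 - d

theorem exists_avoidLim_le_of_canReach (hF : IsUpperSet F) (hp : PullsBack w R) {m : Γ → ℕ}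
    (h : CanReach (R : Set (Γ × (Γ → ℕ))) F m) :
    ∃ c : ℝ, 0 < c ∧ ∀ α, m ≤ α → avoidLim w R F α ≤ 1 - c := by
  induction h with
  | base h => exact ⟨1, one_pos, fun α hα => by simp [avoidLim_of_mem (hF hα h)]⟩
  | @step α r hr h1 _ ih =>
    obtain ⟨c, hc, h⟩ := ih
    obtain ⟨d, hd, h⟩ := hp F α r hr h1 c hc h
    -- The bound `d` is available only outside `F`; inside `F` avoidance has probability `0`, for
    -- which `1` is a valid constant.
    refine ⟨min 1 d, by positivity, fun α' hα' => ?_⟩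
    by_cases hF' : α' ∈ F
    · rw [avoidLim_of_mem hF']
      linarith [min_le_left 1 d]
    · linarith [h α' hα' hF', min_le_right 1 d]

/-- Each element of a finite basis carries its own bound, and the least of these constants serves
everywhere. -/
theorem exists_avoidLim_le (hF : IsUpperSet F) (hp : PullsBack w R) :
    ∃ c : ℝ, 0 < c ∧ ∀ α, CanReach (R : Set (Γ × (Γ → ℕ))) F α → avoidLim w R F α ≤ 1 - c := by
  obtain ⟨K, hK, hKr⟩ := exists_basis_canReach (R := (R : Set (Γ × (Γ → ℕ)))) hF
  choose! c hc hle using fun κ (hκ : κ ∈ K) => exists_avoidLim_le_of_canReach hF hp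
    ((hKr κ).2 ⟨κ, hκ, le_rfl⟩)
  obtain ⟨d, hd, hdc⟩ : ∃ d : ℝ, 0 < d ∧ ∀ κ ∈ K, d ≤ c κ := by
    rcases K.eq_empty_or_nonempty with rfl | hne
    · exact ⟨1, one_pos, by simp⟩
    · obtain ⟨κ, hκ, h⟩ := Set.exists_min_image K c hK hne
      exact ⟨c κ, hc κ hκ, h⟩
  refine ⟨d, hd, fun α hα => ?_⟩
  obtain ⟨κ, hκ, hκα⟩ := (hKr α).1 hα
  linarith [hle κ hκ α hκα, hdc κ hκ]

/-- A run that has avoided `F` for `T` steps is still unable to escape, so it avoids `F` from then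
on with probability at most `1 - c`. Letting `T` tend to infinity leaves `a ≤ a * (1 - c)` for the
limit `a`. -/
theorem avoidLim_eq_zero (hF : IsUpperSet F) (hw : IsScheduler w R) (hp : PullsBack w R)
    {α : Γ → ℕ} (hα : ¬ CanEscape (R : Set (Γ × (Γ → ℕ))) F α) : avoidLim w R F α = 0 := by
  obtain ⟨c, hc, hle⟩ := exists_avoidLim_le hF hp
  have key : ∀ T α, ¬ CanEscape (R : Set (Γ × (Γ → ℕ))) F α →
      avoidLim w R F α ≤ avoid w R F T α * (1 - c) := by
    intro T
    induction T with
    | zero =>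
      intro α hα
      by_cases h : α ∈ F
      · simp [avoidLim_of_mem h, avoid_of_mem h]
      · simpa [avoid, h] using hle α (canReach_of_not_canEscape hα)
    | succ T ih =>
      intro α hα
      by_cases h : α ∈ F
      · simp [avoidLim_of_mem h, avoid_of_mem h]
      by_cases h0 : α = 0
      · subst h0
        rw [avoid_zero_of_notMem h, one_mul]
        exact hle 0 (canReach_of_not_canEscape hα)
      rw [avoidLim_eq hw h h0, avoid_succ h h0, Finset.sum_mul]
      refine Finset.sum_le_sum fun r hr => ?_
      by_cases h1 : α r.1 = 0
      · simp [hw.zero α r hr h1]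
      · rw [mul_assoc]
        refine mul_le_mul_of_nonneg_left (ih _ fun h' => hα ?_) (hw.nonneg α r hr)
        exact .step h hr (Nat.one_le_iff_ne_zero.2 h1) h'
  have := ge_of_tendsto' ((tendsto_avoid hw α).mul_const (1 - c)) fun T => key T α hα
  nlinarith [avoidLim_nonneg (F := F) hw α]

theorem avoid_eq_one_of_not_canReach (hw : IsScheduler w R) {α : Γ → ℕ}
    (h : ¬ CanReach (R : Set (Γ × (Γ → ℕ))) F α) (T : ℕ) : avoid w R F T α = 1 := by
  induction T generalizing α with
  | zero => simp [avoid, show α ∉ F from fun h' => h (.base h')]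
  | succ T ih =>
    have hα : α ∉ F := fun h' => h (.base h')
    by_cases h0 : α = 0
    · subst h0; exact avoid_zero_of_notMem hα _
    rw [avoid_succ hα h0, ← hw.sum_eq α h0]
    refine Finset.sum_congr rfl fun r hr => ?_
    by_cases h1 : α r.1 = 0
    · simp [hw.zero α r hr h1]
    · rw [ih fun h' => h (.step hr (Nat.one_le_iff_ne_zero.2 h1) h'), mul_one]

/-- The constant is the product of the rule weights along an escaping path; at its end avoidance has
probability `1`. -/
theorem exists_le_avoid_of_canEscape (hw : IsScheduler w R) {α : Γ → ℕ}
    (h : CanEscape (R : Set (Γ × (Γ → ℕ))) F α) : ∃ ε : ℝ, 0 < ε ∧ ∀ T, ε ≤ avoid w R F T α := by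
  induction h with
  | base h => exact ⟨1, one_pos, fun T => (avoid_eq_one_of_not_canReach hw h T).ge⟩
  | @step α r hα hr h1 _ ih =>
    obtain ⟨ε, hε, h⟩ := ih
    have hwr := hw.pos α r hr h1
    have h0 : α ≠ 0 := by rintro rfl; simp at h1
    refine ⟨w α r * ε, mul_pos hwr hε, fun T => ?_⟩
    refine le_trans ?_ (avoid_antitone hw α T.le_succ)
    simp only [Nat.succ_eq_add_one, avoid_succ hα h0]
    exact (mul_le_mul_of_nonneg_left (h T) hwr.le).trans (Finset.single_le_sum
      (f := fun r => w α r * avoid w R F T (applyRule α r))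
      (fun r hr => mul_nonneg (hw.nonneg α r hr) (avoid_nonneg hw _ _)) hr)

theorem tendsto_avoid_zero_iff (hF : IsUpperSet F) (hw : IsScheduler w R) (hp : PullsBack w R)
    (α : Γ → ℕ) : Filter.Tendsto (fun T => avoid w R F T α) Filter.atTop (nhds 0) ↔
      ¬ CanEscape (R : Set (Γ × (Γ → ℕ))) F α := by
  constructor
  · intro ht hesc
    obtain ⟨ε, hε, h⟩ := exists_le_avoid_of_canEscape hw hesc
    exact absurd (ge_of_tendsto' ht h) (not_le.2 hε)
  · intro h
    rw [← avoidLim_eq_zero hF hw hp h]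
    exact tendsto_avoid hw α

theorem one_sub_avoidLim_eq (hw : IsScheduler w R) {α : Γ → ℕ} (h : α ∉ F) (h0 : α ≠ 0) :
    1 - avoidLim w R F α = ∑ r ∈ R, w α r * (1 - avoidLim w R F (applyRule α r)) := by
  simp only [mul_sub, mul_one, Finset.sum_sub_distrib, hw.sum_eq α h0, avoidLim_eq hw h h0]

/-! ### The type scheduler and the process scheduler -/

/-- The probability of the rule `r` when a present type is chosen uniformly. -/
noncomputable def weightType (S : PBPP Γ) (α : Γ → ℕ) (r : Γ × (Γ → ℕ)) : ℝ :=
  if 1 ≤ α r.1 then S.prob r / numTypes α else 0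

/-- The probability of the rule `r` when a present process is chosen uniformly. -/
noncomputable def weightProc (S : PBPP Γ) (α : Γ → ℕ) (r : Γ × (Γ → ℕ)) : ℝ :=
  α r.1 * S.prob r / numProcs α

theorem sum_rules_real (S : PBPP Γ) (c : Γ → ℝ) :
    ∑ r ∈ S.rules, c r.1 * S.prob r = ∑ X, c X := by
  rw [← Finset.sum_fiberwise S.rules (fun r => r.1)]
  refine Finset.sum_congr rfl fun X _ => ?_
  rw [Finset.sum_congr rfl (g := fun r => c X * S.prob r)
    (fun r hr => by rw [(Finset.mem_filter.1 hr).2]), ← Finset.mul_sum, ← Rat.cast_sum,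
    S.sum_prob, Rat.cast_one, mul_one]

theorem numTypes_pos {α : Γ → ℕ} (h : α ≠ 0) : 0 < numTypes α := by
  obtain ⟨X, hX⟩ := Function.ne_iff.1 h
  exact Finset.card_pos.2
    ⟨X, Finset.mem_filter.2 ⟨Finset.mem_univ _, Nat.one_le_iff_ne_zero.2 hX⟩⟩

theorem le_numProcs (α : Γ → ℕ) (X : Γ) : α X ≤ numProcs α :=
  Finset.single_le_sum (fun _ _ => Nat.zero_le _) (Finset.mem_univ X)

theorem numProcs_pos {α : Γ → ℕ} (h : α ≠ 0) : 0 < numProcs α := by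
  obtain ⟨X, hX⟩ := Function.ne_iff.1 h
  exact (Nat.pos_of_ne_zero hX).trans_le (le_numProcs α X)

theorem ne_zero_of_one_le {α : Γ → ℕ} {X : Γ} (h : 1 ≤ α X) : α ≠ 0 := by
  rintro rfl; simp at h

theorem isScheduler_weightType (S : PBPP Γ) : IsScheduler S.weightType S.rules where
  nonneg α r hr := by
    have := S.prob_pos r hr
    unfold weightType
    split_ifs <;> positivity
  sum_eq α h0 := by
    have h := S.sum_rules_real (fun X => if 1 ≤ α X then (1 : ℝ) / numTypes α else 0)
    have hn : (numTypes α : ℝ) ≠ 0 := by exact_mod_cast (numTypes_pos h0).ne'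
    rw [← Finset.sum_filter, Finset.sum_const, nsmul_eq_mul] at h
    rw [mul_one_div, ← numTypes, div_self hn] at h
    rw [← h]
    refine Finset.sum_congr rfl fun r _ => ?_
    simp only [weightType, ite_mul, zero_mul]
    congr 1
    ring
  pos α r hr h1 := by
    have := S.prob_pos r hr
    have := numTypes_pos (ne_zero_of_one_le h1)
    rw [weightType, if_pos h1]
    positivity
  zero α r _ h := by simp [weightType, h]

theorem isScheduler_weightProc (S : PBPP Γ) : IsScheduler S.weightProc S.rules where
  nonneg α r hr := by
    have := S.prob_pos r hr
    unfold weightProc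
    positivity
  sum_eq α h0 := by
    have hn : (numProcs α : ℝ) ≠ 0 := by exact_mod_cast (numProcs_pos h0).ne'
    simp only [weightProc]
    rw [← Finset.sum_div, S.sum_rules_real fun X => (α X : ℝ), ← Nat.cast_sum]
    exact div_self hn
  pos α r hr h1 := by
    have := S.prob_pos r hr
    have := numProcs_pos (ne_zero_of_one_le h1)
    rw [weightProc]
    positivity
  zero α r _ h := by simp [weightProc, h]

/-- At most `|Γ|` types are ever present, so `r` fires in the next step with probability at least `p
/ |Γ|`, however large the configuration is. -/
theorem pullsBack_weightType (S : PBPP Γ) : PullsBack S.weightType S.rules := by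
  intro F m r hr h1 c hc hle
  have hw := S.isScheduler_weightType
  have hp : (0 : ℝ) < S.prob r := by exact_mod_cast S.prob_pos r hr
  have hΓ : (0 : ℝ) < Fintype.card Γ := by
    exact_mod_cast Fintype.card_pos_iff.2 ⟨r.1⟩
  refine ⟨S.prob r / Fintype.card Γ * c, by positivity, fun α hα hF => ?_⟩
  have h1' := h1.trans (hα r.1)
  have h0 := ne_zero_of_one_le h1'
  have hn : (0 : ℝ) < numTypes α := by exact_mod_cast numTypes_pos h0
  have hnΓ : (numTypes α : ℝ) ≤ Fintype.card Γ := by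
    exact_mod_cast Finset.card_le_univ _
  rw [le_sub_comm, one_sub_avoidLim_eq hw hF h0]
  calc S.prob r / Fintype.card Γ * c
      ≤ S.weightType α r * (1 - avoidLim S.weightType S.rules F (applyRule α r)) := by
        rw [weightType, if_pos h1']
        have := hle _ (applyRule_mono hα r)
        gcongr
        linarith
    _ ≤ _ := Finset.single_le_sum
      (f := fun r => S.weightType α r * (1 - avoidLim S.weightType S.rules F (applyRule α r)))
      (fun r hr => mul_nonneg (hw.nonneg α r hr) (sub_nonneg.2 (avoidLim_le_one hw _))) hr

theorem numProcs_applyRule_le (α : Γ → ℕ) (r : Γ × (Γ → ℕ)) :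
    numProcs (applyRule α r) ≤ numProcs α + numProcs r.2 := by
  rw [numProcs, numProcs, numProcs, ← Finset.sum_add_distrib]
  refine Finset.sum_le_sum fun X _ => ?_
  simp only [applyRule, Pi.add_apply, Pi.sub_apply]
  lia

/-- Since `N + k * t ≤ (N + k) * (t + 1)`, the sum dominates a multiple of the harmonic series. -/
theorem tendsto_sum_one_div_add_mul {N k : ℝ} (hN : 0 < N) (hk : 0 ≤ k) :
    Filter.Tendsto (fun T : ℕ => ∑ t ∈ Finset.range T, 1 / (N + k * t)) Filter.atTop
      Filter.atTop := by
  refine Filter.tendsto_atTop_mono (fun T => ?_)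
    (Real.tendsto_sum_range_one_div_nat_succ_atTop.const_mul_atTop
      (show (0 : ℝ) < 1 / (N + k) by positivity))
  rw [Finset.mul_sum]
  refine Finset.sum_le_sum fun t _ => ?_
  rw [one_div_mul_one_div]
  gcongr
  nlinarith [mul_nonneg hN.le (Nat.cast_nonneg (α := ℝ) t)]

theorem applyRule_of_lt {m α : Γ → ℕ} (h : m ≤ α) {r : Γ × (Γ → ℕ)} (hr : m r.1 < α r.1) :
    m ≤ applyRule α r := fun X => by
  have := h X
  simp only [applyRule, Pi.add_apply, Pi.sub_apply, Pi.single_apply]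
  split_ifs with hX
  · subst hX; lia
  · lia

/-- Mark a copy of `m` inside `α`. While only unmarked processes are scheduled, the copy survives
and the population grows by at most `k` per step, so a marked process is eventually scheduled almost
surely. The first marked choice then fires `r` with conditional probability at least `p / M`, where
`M` is the size of `m`, and success has probability at least `c` afterwards. Visiting `F` earlier
only helps. -/
theorem pullsBack_weightProc (S : PBPP Γ) : PullsBack S.weightProc S.rules := by
  intro F m r hr h1 c hc hle
  have hw := S.isScheduler_weightProc
  have hp : (0 : ℝ) < S.prob r := by exact_mod_cast S.prob_pos r hr
  set y : (Γ → ℕ) → ℝ := fun α => 1 - avoidLim S.weightProc S.rules F α with hy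
  have hy0 : ∀ α, 0 ≤ y α := fun α => sub_nonneg.2 (avoidLim_le_one hw _)
  have hM1 : (1 : ℝ) ≤ numProcs m := by exact_mod_cast h1.trans (le_numProcs m r.1)
  set M : ℝ := ((numProcs m : ℕ) : ℝ) with hM
  -- The cap at `1` is for configurations already in `F`, where `y` equals `1`.
  set d : ℝ := min 1 (S.prob r * c / M) with hd
  have hd0 : 0 < d := by positivity
  -- A crude bound on the growth caused by any single rule.
  set k : ℕ := ∑ r ∈ S.rules, numProcs r.2 with hk
  -- The exponential bounds the chance that no marked process is scheduled within `T` steps: step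
  -- `t` meets at most `N + k * t` processes, at least one of them marked. A free size bound `N`
  -- lets the induction pass to `N + k`.
  have key : ∀ (T : ℕ) (α : Γ → ℕ) (N : ℝ), m ≤ α → (numProcs α : ℝ) ≤ N →
      d * (1 - Real.exp (-∑ t ∈ Finset.range T, 1 / (N + k * t))) ≤ y α := by
    intro T
    induction T with
    | zero => intro α N _ _; simpa using hy0 α
    | succ T ih =>
      intro α N hα hN
      have h1' := h1.trans (hα r.1)
      have h0 := ne_zero_of_one_le h1'
      have hA : (0 : ℝ) < numProcs α := by exact_mod_cast numProcs_pos h0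
      have hN0 : 0 < N := hA.trans_le hN
      set e : ℝ := Real.exp (-∑ t ∈ Finset.range T, 1 / (N + k + k * t)) with he
      have he1 : e ≤ 1 := by
        rw [he, Real.exp_le_one_iff, neg_nonpos]
        positivity
      have he0 : 0 ≤ e := (Real.exp_pos _).le
      have hsplit : Real.exp (-∑ t ∈ Finset.range (T + 1), 1 / (N + k * t))
          = Real.exp (-(1 / N)) * e := by
        have : ∀ t : ℕ, N + k * ((t + 1 : ℕ) : ℝ) = N + k + k * t := fun t => by push_cast; ring
        rw [Finset.sum_range_succ', neg_add, Real.exp_add, mul_comm, he]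
        simp only [this, Nat.cast_zero, mul_zero, add_zero]
      by_cases hF : α ∈ F
      · simp only [hy, avoidLim_of_mem hF, sub_zero]
        exact mul_le_one₀ (min_le_left _ _)
          (by rw [hsplit, sub_nonneg]
              exact mul_le_one₀ (by rw [Real.exp_le_one_iff]; simp [hN0.le]) he0 he1)
          (by linarith [Real.exp_pos (-∑ t ∈ Finset.range (T + 1), 1 / (N + k * t))])
      -- The weight `α X` splits into `m X` marked and `α X - m X` unmarked processes. Of the marked
      -- part only the contribution of `r` is kept; the unmarked part uses the induction hypothesis,
      -- and if it is empty its weight is `0`.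
      have hterm : ∀ r' ∈ S.rules,
          (if r' = r then S.prob r * c / numProcs α else 0)
            + ((α r'.1 : ℝ) - m r'.1) * S.prob r' / numProcs α * (d * (1 - e))
            ≤ S.weightProc α r' * y (applyRule α r') := by
        intro r' hr'
        have hp' : (0 : ℝ) < S.prob r' := by exact_mod_cast S.prob_pos r' hr'
        have hm : (m r'.1 : ℝ) ≤ α r'.1 := by exact_mod_cast hα r'.1
        have hfst : (if r' = r then S.prob r * c / numProcs α else 0)
            ≤ m r'.1 * S.prob r' / numProcs α * y (applyRule α r') := by
          split_ifs with h
          · subst h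
            have h1R : (1 : ℝ) ≤ m r'.1 := by exact_mod_cast h1
            have hc' : c ≤ y (applyRule α r') := by
              have := hle _ (applyRule_mono hα r')
              simp only [hy]
              linarith
            rw [mul_div_right_comm]
            refine mul_le_mul ?_ hc' hc.le (by positivity)
            gcongr
            exact le_mul_of_one_le_left hp'.le h1R
          · have := hy0 (applyRule α r')
            positivity
        have hsnd : ((α r'.1 : ℝ) - m r'.1) * S.prob r' / numProcs α * (d * (1 - e))
            ≤ ((α r'.1 : ℝ) - m r'.1) * S.prob r' / numProcs α * y (applyRule α r') := by
          rcases (hα r'.1).eq_or_lt with h | h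
          · simp [h]
          · refine mul_le_mul_of_nonneg_left (ih _ (N + k) (applyRule_of_lt hα h) ?_)
              (div_nonneg (mul_nonneg (sub_nonneg.2 hm) hp'.le) hA.le)
            have h2 := numProcs_applyRule_le α r'
            have h3 : numProcs r'.2 ≤ k :=
              Finset.single_le_sum (f := fun r : Γ × (Γ → ℕ) => numProcs r.2)
                (fun _ _ => Nat.zero_le _) hr'
            have h4 : (numProcs (applyRule α r') : ℝ) ≤ numProcs α + k := by
              exact_mod_cast h2.trans (by lia)
            linarith
        calc _ ≤ _ := add_le_add hfst hsnd
          _ = _ := by rw [weightProc]; ring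
      have hsum := Finset.sum_le_sum hterm
      rw [← one_sub_avoidLim_eq hw hF h0, Finset.sum_add_distrib, Finset.sum_ite_eq' S.rules r,
        if_pos hr, ← Finset.sum_mul, ← Finset.sum_div,
        S.sum_rules_real (fun X => (α X : ℝ) - m X), Finset.sum_sub_distrib,
        ← Nat.cast_sum, ← Nat.cast_sum] at hsum
      change S.prob r * c / numProcs α + (numProcs α - M) / numProcs α * (d * (1 - e)) ≤ y α at hsum
      have hdM : d * M ≤ S.prob r * c := by
        rw [← le_div_iff₀ (by linarith)]
        exact min_le_right _ _
      -- The chance of an unmarked choice is compared with the first factor split off the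
      -- exponential, using `1 ≤ M` and `numProcs α ≤ N`.
      have h5 : 1 - M / numProcs α ≤ Real.exp (-(1 / N)) := by
        have : 1 / N ≤ M / numProcs α := by gcongr
        linarith [Real.one_sub_le_exp_neg (1 / N)]
      rw [hsplit]
      calc d * (1 - Real.exp (-(1 / N)) * e)
          ≤ d * (1 - (1 - M / numProcs α) * e) := by gcongr
        _ = d * M / numProcs α + (numProcs α - M) / numProcs α * (d * (1 - e)) := by
            field_simp
            ring
        _ ≤ S.prob r * c / numProcs α + (numProcs α - M) / numProcs α * (d * (1 - e)) := by
            gcongr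
        _ ≤ y α := hsum
  refine ⟨d, hd0, fun α hα _ => ?_⟩
  have hA : (0 : ℝ) < numProcs α := by
    exact_mod_cast numProcs_pos (ne_zero_of_one_le (h1.trans (hα r.1)))
  have hlim := ((Real.tendsto_exp_neg_atTop_nhds_zero.comp
    (tendsto_sum_one_div_add_mul hA (Nat.cast_nonneg k))).const_sub 1).const_mul d
  have := le_of_tendsto' hlim fun T => key T α _ hα le_rfl
  simp only [hy] at this
  linarith

end PBPP

/-! ### From the trajectory measure to finite-horizon avoidance -/

namespace MarkovChain

set_option linter.unusedSectionVars false

variable {Q : Type*} [Countable Q] [MeasurableSpace Q] [DiscreteMeasurableSpace Q]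

open Classical in
/-- The probability of avoiding `F` during `T` steps of the chain. -/
noncomputable def avoidProb (M : MarkovChain Q) (F : Set Q) : ℕ → Q → ENNReal
  | 0, q => if q ∈ F then 0 else 1
  | T + 1, q => if q ∈ F then 0 else ∑' q', M.δ q q' * avoidProb M F T q'

open Classical in
/-- The expectation of `g` after one step, restricted to the event of avoiding `F`. -/
noncomputable def stepAvoid (M : MarkovChain Q) (F : Set Q) (g : Q → ENNReal) (q : Q) : ENNReal :=
  ∑' q', M.δ q q' * if q' ∈ F then 0 else g q'

instance (M : MarkovChain Q) (s₀ : Q) : IsProbabilityMeasure (M.trajLaw s₀) := by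
  unfold trajLaw; infer_instance

open Classical in
theorem avoidProb_eq_iterate (M : MarkovChain Q) (F : Set Q) (T : ℕ) (q : Q) :
    M.avoidProb F T q = if q ∈ F then 0 else (M.stepAvoid F)^[T] 1 q := by
  induction T generalizing q with
  | zero => simp [avoidProb]
  | succ T ih =>
    simp only [avoidProb, Function.iterate_succ_apply', stepAvoid, ih]

theorem map_eval_zero_trajLaw (M : MarkovChain Q) (s₀ : Q) :
    (M.trajLaw s₀).map (fun ω => ω 0) = Measure.dirac s₀ := by
  have h : (fun ω : ℕ → Q => ω 0) =
      (fun x : (i : Finset.Iic 0) → Q => x ⟨0, Finset.mem_Iic.2 le_rfl⟩) ∘ Preorder.frestrictLe 0 :=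
    rfl
  rw [h, ← Measure.map_map (by fun_prop) (by fun_prop), trajLaw, Kernel.trajMeasure,
    Measure.map_comp _ _ (by fun_prop), Kernel.traj_map_frestrictLe, Kernel.partialTraj_self,
    Measure.id_comp, Measure.map_map (by fun_prop) (by fun_prop)]
  exact Measure.map_id

-- The trajectory measure is disintegrated at its last step, whereas `avoidProb` recurses on the
-- first. Both are iterates of the operator `stepAvoid`; a general `g` is needed because the last
-- step is absorbed into it.
open Classical in
theorem lintegral_avoid (M : MarkovChain Q) (F : Set Q) (s₀ : Q) (T : ℕ) (g : Q → ENNReal) :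
    ∫⁻ ω, (if ∀ i ≤ T, ω i ∉ F then g (ω T) else 0) ∂M.trajLaw s₀
      = if s₀ ∈ F then 0 else (M.stepAvoid F)^[T] g s₀ := by
  induction T generalizing g with
  | zero =>
    have h := lintegral_map (μ := M.trajLaw s₀) (f := fun q => if q ∉ F then g q else 0)
      (g := fun ω => ω 0) Measurable.of_discrete (by fun_prop)
    rw [map_eval_zero_trajLaw, lintegral_dirac] at h
    simpa using h.symm
  | succ T ih =>
    let f : ((i : Finset.Iic T) → Q) × Q → ENNReal :=
      fun p => if (∀ i, p.1 i ∉ F) ∧ p.2 ∉ F then g p.2 else 0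
    have hf : Measurable f := Measurable.of_discrete
    have h1 : ∀ ω : ℕ → Q, (if ∀ i ≤ T + 1, ω i ∉ F then g (ω (T + 1)) else 0)
        = f (Preorder.frestrictLe T ω, ω (T + 1)) := by
      intro ω
      simp only [f]
      congr 1
      simp [Nat.le_succ_iff, or_imp, forall_and]
    have h2 : ∀ ω : ℕ → Q, (∫⁻ q, f (Preorder.frestrictLe T ω, q)
          ∂M.stepKernel T (Preorder.frestrictLe T ω))
        = if ∀ i ≤ T, ω i ∉ F then M.stepAvoid F g (ω T) else 0 := by
      intro ω
      have h3 : M.stepKernel T (Preorder.frestrictLe T ω) = (M.δ (ω T)).toMeasure := rfl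
      rw [h3, lintegral_countable']
      by_cases h : ∀ i ≤ T, ω i ∉ F
      · rw [if_pos h, stepAvoid]
        refine tsum_congr fun q => ?_
        rw [PMF.toMeasure_apply_singleton _ _ (MeasurableSet.singleton q), mul_comm]
        congr 1
        have : ∀ i : Finset.Iic T, Preorder.frestrictLe (π := fun _ => Q) T ω i ∉ F :=
          fun i => h i (Finset.mem_Iic.1 i.2)
        by_cases hq : q ∈ F
        · simp [f, hq]
        · simp only [f, hq, if_false, not_false_eq_true, and_true]
          rw [if_pos this]
      · rw [if_neg h]
        have : ∀ q, f (Preorder.frestrictLe T ω, q) = 0 := fun q => by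
          refine if_neg fun h' => h fun i hi => ?_
          exact h'.1 ⟨i, Finset.mem_Iic.2 hi⟩
        simp [this]
    simp only [h1]
    rw [← lintegral_map (μ := M.trajLaw s₀) (f := f)
      (g := fun ω => (Preorder.frestrictLe T ω, ω (T + 1))) hf (by fun_prop), trajLaw,
      ← Kernel.map_frestrictLe_trajMeasure_compProd_eq_map_trajMeasure,
      Measure.lintegral_compProd hf, lintegral_map (by exact Measurable.of_discrete) (by fun_prop)]
    simp only [h2]
    rw [← trajLaw, ih, Function.iterate_succ_apply]

theorem measurableSet_avoid (F : Set Q) (T : ℕ) : MeasurableSet {ω : ℕ → Q | ∀ i ≤ T, ω i ∉ F} := by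
  have : {ω : ℕ → Q | ∀ i ≤ T, ω i ∉ F} = ⋂ i, ⋂ (_ : i ≤ T), (fun ω => ω i) ⁻¹' Fᶜ := by
    ext; simp
  rw [this]
  exact .iInter fun i => .iInter fun _ => measurable_pi_apply i .of_discrete

theorem trajLaw_avoid (M : MarkovChain Q) (F : Set Q) (s₀ : Q) (T : ℕ) :
    M.trajLaw s₀ {ω | ∀ i ≤ T, ω i ∉ F} = M.avoidProb F T s₀ := by
  classical
  rw [avoidProb_eq_iterate, ← lintegral_avoid, ← lintegral_indicator_one (measurableSet_avoid F T)]
  refine lintegral_congr fun ω => ?_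
  simp [Set.indicator_apply]

/-- Never visiting `F` is the decreasing intersection of the finite-horizon avoidance events, so
continuity from above applies. -/
theorem probReach_eq_one_iff (M : MarkovChain Q) (F : Set Q) (s₀ : Q) :
    M.probReach s₀ F = 1 ↔
      Filter.Tendsto (fun T => M.avoidProb F T s₀) Filter.atTop (nhds 0) := by
  have hI : {ω : ℕ → Q | ∃ i, ω i ∈ F}ᶜ = ⋂ T, {ω : ℕ → Q | ∀ i ≤ T, ω i ∉ F} := by
    ext ω
    simp only [Set.mem_compl_iff, Set.mem_ofPred_eq, not_exists, Set.mem_iInter]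
    exact ⟨fun h T i _ => h i, fun h i => h i i le_rfl⟩
  have hmE : MeasurableSet {ω : ℕ → Q | ∃ i, ω i ∈ F} := by
    rw [← MeasurableSet.compl_iff, hI]
    exact .iInter (measurableSet_avoid F)
  have ht := tendsto_measure_iInter_atTop (μ := M.trajLaw s₀) (fun T => (measurableSet_avoid F T).nullMeasurableSet)
    (fun T T' h ω hω i hi => hω i (hi.trans h)) ⟨0, measure_ne_top _ _⟩
  simp only [Function.comp_def, trajLaw_avoid, ← hI] at ht
  rw [probReach, ← prob_compl_eq_zero_iff hmE]
  exact ⟨fun h => h ▸ ht, fun h => tendsto_nhds_unique ht h⟩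

end MarkovChain

/-! ### The two chains as schedulers -/

namespace PBPP

set_option linter.unusedSectionVars false

variable {Γ : Type*} [Fintype Γ] [DecidableEq Γ]

/-- Different rules may lead to the same configuration; a sum over successors is regrouped as a sum
over rules. -/
theorem tsum_fiber (R : Finset (Γ × (Γ → ℕ))) (w : Γ × (Γ → ℕ) → ℝ) (hw : ∀ r ∈ R, 0 ≤ w r)
    (next : Γ × (Γ → ℕ) → Γ → ℕ) (p : (Γ → ℕ) → ℝ)
    (hp : ∀ γ, p γ = ∑ r ∈ R with γ = next r, w r) (v : (Γ → ℕ) → ℝ) (hv : ∀ γ, 0 ≤ v γ) :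
    ∑' γ, ENNReal.ofReal (p γ) * ENNReal.ofReal (v γ)
      = ENNReal.ofReal (∑ r ∈ R, w r * v (next r)) := by
  have e : ∀ γ, ENNReal.ofReal (p γ) * ENNReal.ofReal (v γ)
      = ∑ r ∈ R, if γ = next r then ENNReal.ofReal (w r * v (next r)) else 0 := by
    intro γ
    rw [hp, Finset.sum_filter, ← ENNReal.ofReal_mul' (hv γ), Finset.sum_mul,
      ENNReal.ofReal_sum_of_nonneg]
    · refine Finset.sum_congr rfl fun r _ => ?_
      split_ifs with h
      · rw [h]
      · simp
    · intro r hr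
      split_ifs
      · exact mul_nonneg (hw r hr) (hv γ)
      · simp
  rw [ENNReal.ofReal_sum_of_nonneg fun r hr => mul_nonneg (hw r hr) (hv _)]
  simp_rw [e]
  rw [Summable.tsum_finsetSum fun _ _ => ENNReal.summable]
  exact Finset.sum_congr rfl fun r _ => tsum_ite_eq _ _

theorem avoidProb_eq_ofReal {w : (Γ → ℕ) → Γ × (Γ → ℕ) → ℝ} {R : Finset (Γ × (Γ → ℕ))}
    (hw : IsScheduler w R) (M : MarkovChain (Γ → ℕ)) (p : (Γ → ℕ) → (Γ → ℕ) → ℝ)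
    (hM : ∀ α γ, M.δ α γ = ENNReal.ofReal (p α γ)) (h0 : ∀ γ, p 0 γ = if γ = 0 then 1 else 0)
    (hp : ∀ α, α ≠ 0 → ∀ γ, p α γ = ∑ r ∈ R with γ = applyRule α r, w α r)
    (F : Set (Γ → ℕ)) (T : ℕ) (α : Γ → ℕ) :
    M.avoidProb F T α = ENNReal.ofReal (avoid w R F T α) := by
  induction T generalizing α with
  | zero =>
    rw [MarkovChain.avoidProb, avoid]
    split_ifs <;> simp
  | succ T ih =>
    rw [MarkovChain.avoidProb, avoid]
    split_ifs with h hα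
    · simp
    · subst hα
      simp only [hM, h0, ih]
      rw [tsum_eq_single 0 (by intro γ hγ; simp [hγ])]
      simp
    · simp only [hM, ih]
      exact tsum_fiber R (w α) (hw.nonneg α) (applyRule α) (p α) (hp α hα) _ (avoid_nonneg hw T)

theorem probReach_eq_one_iff_of_scheduler {w : (Γ → ℕ) → Γ × (Γ → ℕ) → ℝ}
    {R : Finset (Γ × (Γ → ℕ))} (hw : IsScheduler w R) (hpull : PullsBack w R)
    (M : MarkovChain (Γ → ℕ)) (p : (Γ → ℕ) → (Γ → ℕ) → ℝ)
    (hM : ∀ α γ, M.δ α γ = ENNReal.ofReal (p α γ)) (h0 : ∀ γ, p 0 γ = if γ = 0 then 1 else 0)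
    (hp : ∀ α, α ≠ 0 → ∀ γ, p α γ = ∑ r ∈ R with γ = applyRule α r, w α r)
    {F : Set (Γ → ℕ)} (hF : IsUpperSet F) (α : Γ → ℕ) :
    M.probReach α F = 1 ↔ ¬ CanEscape (R : Set (Γ × (Γ → ℕ))) F α := by
  rw [MarkovChain.probReach_eq_one_iff, ← tendsto_avoid_zero_iff hF hw hpull]
  simp only [avoidProb_eq_ofReal hw M p hM h0 hp]
  constructor
  · intro h
    have := (ENNReal.tendsto_toReal ENNReal.zero_ne_top).comp h
    simpa [Function.comp_def, ENNReal.toReal_ofReal (avoid_nonneg hw _ _)] using this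
  · intro h
    simpa using ENNReal.tendsto_ofReal h

theorem probReach_chainType_eq_one_iff (S : PBPP Γ) {F : Set (Γ → ℕ)} (hF : IsUpperSet F)
    (α : Γ → ℕ) : S.chainType.probReach α F = 1 ↔
      ¬ CanEscape (S.rules : Set (Γ × (Γ → ℕ))) F α := by
  refine probReach_eq_one_iff_of_scheduler S.isScheduler_weightType S.pullsBack_weightType _
    (fun α γ => (S.stepType α γ : ℝ)) (fun _ _ => rfl) (fun γ => ?_) (fun α hα γ => ?_) hF α
  · simp only [stepType, if_true]
    split_ifs <;> simp
  · simp only [stepType, hα, if_false, weightType]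
    push_cast
    rw [← Finset.sum_filter, Finset.filter_filter]
    refine Finset.sum_congr ?_ fun _ _ => rfl
    simp only [and_comm]

theorem probReach_chainProc_eq_one_iff (S : PBPP Γ) {F : Set (Γ → ℕ)} (hF : IsUpperSet F)
    (α : Γ → ℕ) : S.chainProc.probReach α F = 1 ↔
      ¬ CanEscape (S.rules : Set (Γ × (Γ → ℕ))) F α := by
  refine probReach_eq_one_iff_of_scheduler S.isScheduler_weightProc S.pullsBack_weightProc _
    (fun α γ => (S.stepProc α γ : ℝ)) (fun _ _ => rfl) (fun γ => ?_) (fun α hα γ => ?_) hF α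
  · simp only [stepProc, if_true]
    split_ifs <;> simp
  · simp only [stepProc, hα, if_false, weightProc]
    push_cast
    rfl

end PBPP

/-! ### Searching for certificates -/

section Primrec

variable {α β : Type*} [Primcodable α] [Primcodable β]

theorem PrimrecPred.exists_mem {l : α → List β} (hl : Primrec l) {p : α → β → Prop}
    (hp : PrimrecPred fun x : α × β => p x.1 x.2) : PrimrecPred fun a => ∃ b ∈ l a, p a b :=
  (PrimrecRel.exists_mem_list (R := fun b a => p a b)
    (PrimrecPred.comp (p := fun x : α × β => p x.1 x.2) (f := fun x : β × α => (x.2, x.1)) hp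
      (Primrec.snd.pair Primrec.fst)).primrecRel).comp hl Primrec.id

theorem PrimrecPred.forall_mem {l : α → List β} (hl : Primrec l) {p : α → β → Prop}
    (hp : PrimrecPred fun x : α × β => p x.1 x.2) : PrimrecPred fun a => ∀ b ∈ l a, p a b :=
  (PrimrecRel.forall_mem_list (R := fun b a => p a b)
    (PrimrecPred.comp (p := fun x : α × β => p x.1 x.2) (f := fun x : β × α => (x.2, x.1)) hp
      (Primrec.snd.pair Primrec.fst)).primrecRel).comp hl Primrec.id

theorem PrimrecPred.imp {p q : α → Prop} (hp : PrimrecPred p) (hq : PrimrecPred q) :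
    PrimrecPred fun a => p a → q a :=
  (hp.not.or hq).of_eq fun _ => imp_iff_not_or.symm

/-- If each input has a witness of one of two mutually exclusive primitive recursive relations,
then it is computable which one it is. -/
theorem exists_computable_of_certificates {p q : α → β → Prop}
    (hp : PrimrecPred fun x : α × β => p x.1 x.2) (hq : PrimrecPred fun x : α × β => q x.1 x.2)
    (hdisj : ∀ a, (∃ b, p a b) → ¬ ∃ b, q a b) (htot : ∀ a, (∃ b, p a b) ∨ ∃ b, q a b) :
    ∃ f : α → Bool, Computable f ∧ ∀ a, f a = true ↔ ∃ b, p a b := by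
  classical
  -- The number `n` is decoded as a candidate witness and tested against both relations; an
  -- unbounded search for the first answer is total by `htot`.
  let g : α → ℕ → Option Bool := fun a n => (Encodable.decode (α := β) n).bind fun b =>
    if p a b then some true else if q a b then some false else none
  have hg : Primrec₂ g := by
    refine Primrec.option_bind (Primrec.decode.comp Primrec.snd) ?_
    have hc : Primrec fun x : (α × ℕ) × β => (x.1.1, x.2) :=
      (Primrec.fst.comp Primrec.fst).pair Primrec.snd
    exact Primrec.ite (hp.comp hc) (Primrec.const _)
      (Primrec.ite (hq.comp hc) (Primrec.const _) (Primrec.const _))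
  have hr : Partrec fun a => Nat.rfindOpt (g a) := Partrec.rfindOpt hg.to_comp
  have hdom : ∀ a, (Nat.rfindOpt (g a)).Dom := by
    intro a
    rw [Nat.rfindOpt_dom]
    rcases htot a with ⟨b, hb⟩ | ⟨b, hb⟩
    · exact ⟨Encodable.encode b, true, by simp [g, hb]⟩
    · have : ¬ p a b := fun h => hdisj a ⟨b, h⟩ ⟨b, hb⟩
      exact ⟨Encodable.encode b, false, by simp [g, hb, this]⟩
  refine ⟨fun a => (Nat.rfindOpt (g a)).get (hdom a), ?_, fun a => ?_⟩
  · exact hr.of_eq fun a => (Part.some_get (hdom a)).symm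
  · obtain ⟨n, hn⟩ := Nat.rfindOpt_spec (Part.get_mem (hdom a))
    set v := (Nat.rfindOpt (g a)).get (hdom a)
    simp only [g, Option.mem_def, Option.bind_eq_some_iff] at hn
    obtain ⟨b, -, hb⟩ := hn
    split_ifs at hb with h1 h2
    · simp only [Option.some.injEq] at hb
      exact ⟨fun _ => ⟨b, h1⟩, fun _ => hb.symm⟩
    · simp only [Option.some.injEq] at hb
      exact ⟨fun h => absurd (hb.trans h) Bool.false_ne_true, fun h => absurd ⟨b, h2⟩ (hdisj a h)⟩

end Primrec

/-! ### Configurations, rules and certificates as lists -/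

namespace PBPP

/-- The configuration over `n` types that a list presents; missing entries are zero. -/
def ofList (n : ℕ) (l : List ℕ) : Fin n → ℕ := fun i => l.getD i 0

/-- Componentwise comparison of the first `n` entries. -/
def ListLE (n : ℕ) (a b : List ℕ) : Prop := ∀ i ∈ List.range n, a.getD i 0 ≤ b.getD i 0

/-- The list `[f 0, …, f (n - 1)]`. -/
def tabulate (n : ℕ) (f : ℕ → ℕ) : List ℕ := (List.range n).map f

/-- A rule of an input. -/
abbrev InputRule : Type := ℕ × List ℕ × ℕ × ℕ

/-- `applyRule` on lists. -/
def applyList (n : ℕ) (a : List ℕ) (q : InputRule) : List ℕ :=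
  tabulate n fun i => a.getD i 0 - (if i = q.1 then 1 else 0) + q.2.1.getD i 0

/-- The join of a configuration with a single process, on lists. -/
def enableList (n : ℕ) (a : List ℕ) (q : InputRule) : List ℕ :=
  tabulate n fun i => max (a.getD i 0) (if i = q.1 then 1 else 0)

/-- The least configuration from which the rule `q` leads above `a`, on lists. -/
def preList (n : ℕ) (a : List ℕ) (q : InputRule) : List ℕ :=
  tabulate n fun i => a.getD i 0 - q.2.1.getD i 0 + (if i = q.1 then 1 else 0)

theorem listLE_iff {n : ℕ} {a b : List ℕ} : ListLE n a b ↔ ofList n a ≤ ofList n b := by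
  simp only [ListLE, List.mem_range, Pi.le_def, ofList]
  exact ⟨fun h i => h i i.2, fun h i hi => h ⟨i, hi⟩⟩

theorem ofList_tabulate (n : ℕ) (f : ℕ → ℕ) : ofList n (tabulate n f) = fun i : Fin n => f i := by
  funext i
  simp [ofList, tabulate]

theorem ofList_ofFn {n : ℕ} (α : Fin n → ℕ) : ofList n (List.ofFn α) = α := by
  funext i
  simp [ofList]

/-- The rule over `n` types that is presented by `q`. -/
def ruleOf {n : ℕ} (q : InputRule) (h : q.1 < n) : Fin n × (Fin n → ℕ) :=
  (⟨q.1, h⟩, ofList n q.2.1)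

theorem ofList_applyList {n : ℕ} (a : List ℕ) {q : InputRule} (h : q.1 < n) :
    ofList n (applyList n a q) = applyRule (ofList n a) (ruleOf q h) := by
  rw [applyList, ofList_tabulate]
  funext i
  simp [applyRule, ruleOf, ofList, Pi.single_apply, Fin.ext_iff]

theorem ofList_enableList {n : ℕ} (a : List ℕ) {q : InputRule} (h : q.1 < n) :
    ofList n (enableList n a q) = ofList n a ⊔ Pi.single (ruleOf q h).1 1 := by
  rw [enableList, ofList_tabulate]
  funext i
  simp [ruleOf, ofList, Pi.single_apply, Fin.ext_iff]

theorem ofList_preList {n : ℕ} (a : List ℕ) {q : InputRule} (h : q.1 < n) :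
    ofList n (preList n a q)
      = ofList n a - (ruleOf q h).2 + Pi.single (ruleOf q h).1 1 := by
  rw [preList, ofList_tabulate]
  funext i
  simp [ruleOf, ofList, Pi.single_apply, Fin.ext_iff]

/-- The rules over `n` types of a list of rules; rules for other types are ignored. -/
def rulesOf (n : ℕ) (L : List InputRule) : Set (Fin n × (Fin n → ℕ)) :=
  {r | ∃ q ∈ L, ∃ h : q.1 < n, r = ruleOf q h}

/-- The upward closure of the listed configurations. -/
def targetOf (n : ℕ) (φs : List (List ℕ)) : Set (Fin n → ℕ) :=
  {β | ∃ φ ∈ φs, ofList n φ ≤ β}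

theorem isUpperSet_targetOf (n : ℕ) (φs : List (List ℕ)) : IsUpperSet (targetOf n φs) :=
  fun _ _ h ⟨φ, hφ, hle⟩ => ⟨φ, hφ, hle.trans h⟩

/-- Certificates: a list of ranked configurations and a list of configurations. -/
abbrev Cert : Type := List (List ℕ × ℕ) × List (List ℕ)

/-- `IsReachCert` on lists. -/
def ReachCheck (x : Input) (c : Cert) : Prop :=
  (∃ g ∈ c.1, ListLE x.1 g.1 x.2.2.2) ∧
  (∀ g ∈ c.1, ∀ q ∈ x.2.1, q.1 < x.1 →
    (∃ φ ∈ x.2.2.1, ListLE x.1 φ (enableList x.1 g.1 q)) ∨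
      ∃ g' ∈ c.1, ListLE x.1 g'.1 (applyList x.1 (enableList x.1 g.1 q) q)) ∧
  ∀ g ∈ c.1, (∃ φ ∈ x.2.2.1, ListLE x.1 φ g.1) ∨
    ∃ q ∈ x.2.1, q.1 < x.1 ∧ 1 ≤ g.1.getD q.1 0 ∧
      ∃ g' ∈ c.1, g'.2 < g.2 ∧ ListLE x.1 g'.1 (applyList x.1 g.1 q)

/-- `IsEscapeCert` on lists. -/
def EscapeCheck (x : Input) (c : Cert) : Prop :=
  (∃ g ∈ c.1, ListLE x.1 x.2.2.2 g.1) ∧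
  (∀ g ∈ c.1, (¬ ∃ φ ∈ x.2.2.1, ListLE x.1 φ g.1) ∧ ((¬ ∃ κ ∈ c.2, ListLE x.1 κ g.1) ∨
    ∃ q ∈ x.2.1, q.1 < x.1 ∧ 1 ≤ g.1.getD q.1 0 ∧
      ∃ g' ∈ c.1, g'.2 < g.2 ∧ ListLE x.1 (applyList x.1 g.1 q) g'.1)) ∧
  (∀ φ ∈ x.2.2.1, ∃ κ ∈ c.2, ListLE x.1 κ φ) ∧
  ∀ κ ∈ c.2, ∀ q ∈ x.2.1, q.1 < x.1 → ∃ κ' ∈ c.2, ListLE x.1 κ' (preList x.1 κ q)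

theorem exists_mem_rulesOf {n : ℕ} {L : List InputRule} {p : Fin n × (Fin n → ℕ) → Prop} :
    (∃ r ∈ rulesOf n L, p r) ↔ ∃ q ∈ L, ∃ h : q.1 < n, p (ruleOf q h) := by
  constructor
  · rintro ⟨_, ⟨q, hq, h, rfl⟩, hp⟩
    exact ⟨q, hq, h, hp⟩
  · rintro ⟨q, hq, h, hp⟩
    exact ⟨_, ⟨q, hq, h, rfl⟩, hp⟩

theorem forall_mem_rulesOf {n : ℕ} {L : List InputRule} {p : Fin n × (Fin n → ℕ) → Prop} :
    (∀ r ∈ rulesOf n L, p r) ↔ ∀ q ∈ L, ∀ h : q.1 < n, p (ruleOf q h) := by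
  constructor
  · exact fun hp q hq h => hp _ ⟨q, hq, h, rfl⟩
  · rintro hp _ ⟨q, hq, h, rfl⟩
    exact hp q hq h

/-- The ranked configurations of a certificate. -/
def rankedOf (n : ℕ) (C : List (List ℕ × ℕ)) : Set ((Fin n → ℕ) × ℕ) :=
  (fun g => (ofList n g.1, g.2)) '' {g | g ∈ C}

/-- The listed configurations. -/
def configsOf (n : ℕ) (K : List (List ℕ)) : Set (Fin n → ℕ) := ofList n '' {κ | κ ∈ K}

theorem exists_rankedOf_eq {n : ℕ} {C : Set ((Fin n → ℕ) × ℕ)} (hC : C.Finite) :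
    ∃ l, rankedOf n l = C := by
  refine ⟨hC.toFinset.toList.map fun g => (List.ofFn g.1, g.2), ?_⟩
  ext g
  simp [rankedOf, ofList_ofFn, Prod.ext_iff]

theorem exists_configsOf_eq {n : ℕ} {K : Set (Fin n → ℕ)} (hK : K.Finite) :
    ∃ l, configsOf n l = K := by
  refine ⟨hK.toFinset.toList.map List.ofFn, ?_⟩
  ext g
  simp [configsOf, ofList_ofFn]

section

variable {n : ℕ} {C : List (List ℕ × ℕ)} {K : List (List ℕ)} {p : (Fin n → ℕ) × ℕ → Prop}
  {p' : (Fin n → ℕ) → Prop}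

theorem exists_mem_rankedOf : (∃ g ∈ rankedOf n C, p g) ↔ ∃ g ∈ C, p (ofList n g.1, g.2) :=
  Set.exists_mem_image

theorem forall_mem_rankedOf : (∀ g ∈ rankedOf n C, p g) ↔ ∀ g ∈ C, p (ofList n g.1, g.2) :=
  Set.forall_mem_image

theorem exists_mem_configsOf : (∃ κ ∈ configsOf n K, p' κ) ↔ ∃ κ ∈ K, p' (ofList n κ) :=
  Set.exists_mem_image

theorem forall_mem_configsOf : (∀ κ ∈ configsOf n K, p' κ) ↔ ∀ κ ∈ K, p' (ofList n κ) :=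
  Set.forall_mem_image

theorem mem_targetOf {φs : List (List ℕ)} {β : Fin n → ℕ} :
    β ∈ targetOf n φs ↔ ∃ φ ∈ φs, ofList n φ ≤ β := Iff.rfl

end

theorem reachCheck_iff (x : Input) (c : Cert) :
    ReachCheck x c ↔ IsReachCert (rulesOf x.1 x.2.1) (targetOf x.1 x.2.2.1) (rankedOf x.1 c.1)
      (ofList x.1 x.2.2.2) := by
  rw [isReachCert_iff]
  simp only [ReachCheck, exists_mem_rankedOf, forall_mem_rankedOf, forall_mem_rulesOf,
    exists_mem_rulesOf, mem_targetOf, listLE_iff]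
  refine and_congr_right' (and_congr ?_ ?_)
  · refine forall₂_congr fun g _ => forall₂_congr fun q _ => forall_congr' fun h => ?_
    rw [ofList_applyList _ h, ofList_enableList _ h]
  · refine forall₂_congr fun g _ => or_congr_right (exists_congr fun q => and_congr_right fun _ =>
      exists_prop.symm.trans (exists_congr fun h => ?_))
    rw [ofList_applyList _ h]
    rfl

theorem escapeCheck_iff (x : Input) (c : Cert) :
    EscapeCheck x c ↔ IsEscapeCert (rulesOf x.1 x.2.1) (targetOf x.1 x.2.2.1) (rankedOf x.1 c.1)
      (configsOf x.1 c.2) (ofList x.1 x.2.2.2) := by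
  rw [isEscapeCert_iff]
  simp only [EscapeCheck, exists_mem_rankedOf, forall_mem_rankedOf, forall_mem_rulesOf,
    exists_mem_rulesOf, exists_mem_configsOf, forall_mem_configsOf, mem_targetOf, listLE_iff]
  refine and_congr_right' (and_congr ?_ (and_congr ?_ ?_))
  · refine forall₂_congr fun g _ => and_congr_right' (or_congr_right (exists_congr fun q =>
      and_congr_right fun _ => exists_prop.symm.trans (exists_congr fun h => ?_)))
    rw [ofList_applyList _ h]
    rfl
  -- The check inspects only the generators of `F`; the rest of `F` follows by transitivity.
  · refine ⟨fun h β ⟨φ, hφ, hle⟩ => ?_, fun h φ hφ => h _ ⟨φ, hφ, le_rfl⟩⟩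
    obtain ⟨κ, hκ, hκφ⟩ := h φ hφ
    exact ⟨κ, hκ, hκφ.trans hle⟩
  · refine forall₂_congr fun κ _ => forall₂_congr fun q _ => forall_congr' fun h => ?_
    rw [ofList_preList _ h]

/-! ### Primitive recursiveness of the checks -/

section

variable {α : Type*} [Primcodable α]

theorem primrecPred_listLE {n : α → ℕ} {a b : α → List ℕ} (hn : Primrec n) (ha : Primrec a)
    (hb : Primrec b) : PrimrecPred fun x => ListLE (n x) (a x) (b x) :=
  PrimrecPred.forall_mem (Primrec.list_range.comp hn)
    (Primrec.nat_le.comp ((Primrec.list_getD 0).comp (ha.comp Primrec.fst) Primrec.snd)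
      ((Primrec.list_getD 0).comp (hb.comp Primrec.fst) Primrec.snd))

theorem primrec_tabulate {n : α → ℕ} {f : α → ℕ → ℕ} (hn : Primrec n) (hf : Primrec₂ f) :
    Primrec fun x => tabulate (n x) (f x) :=
  Primrec.list_map (Primrec.list_range.comp hn) hf

theorem primrec_indicator {q : α → InputRule} (hq : Primrec q) :
    Primrec₂ fun (x : α) (i : ℕ) => if i = (q x).1 then 1 else 0 :=
  Primrec.ite (Primrec.eq.comp Primrec.snd (Primrec.fst.comp (hq.comp Primrec.fst)))
    (Primrec.const 1) (Primrec.const 0)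

theorem primrec_entry {a : α → List ℕ} (ha : Primrec a) :
    Primrec₂ fun (x : α) (i : ℕ) => (a x).getD i 0 :=
  (Primrec.list_getD 0).comp (ha.comp Primrec.fst) Primrec.snd

variable {n : α → ℕ} {a : α → List ℕ} {q : α → InputRule}

theorem primrec_applyList (hn : Primrec n) (ha : Primrec a) (hq : Primrec q) :
    Primrec fun x => applyList (n x) (a x) (q x) :=
  primrec_tabulate hn (Primrec.nat_add.comp (Primrec.nat_sub.comp (primrec_entry ha)
    (primrec_indicator hq)) (primrec_entry (Primrec.fst.comp (Primrec.snd.comp hq))))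

theorem primrec_enableList (hn : Primrec n) (ha : Primrec a) (hq : Primrec q) :
    Primrec fun x => enableList (n x) (a x) (q x) :=
  primrec_tabulate hn (Primrec.nat_max.comp (primrec_entry ha) (primrec_indicator hq))

theorem primrec_preList (hn : Primrec n) (ha : Primrec a) (hq : Primrec q) :
    Primrec fun x => preList (n x) (a x) (q x) :=
  primrec_tabulate hn (Primrec.nat_add.comp (Primrec.nat_sub.comp (primrec_entry ha)
    (primrec_entry (Primrec.fst.comp (Primrec.snd.comp hq)))) (primrec_indicator hq))

end

section

variable {α : Type*} [Primcodable α] {x : α → Input} {c : α → List (List ℕ × ℕ)}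
  {k : α → List (List ℕ)} {g : α → List ℕ × ℕ} {a : α → List ℕ} {q : α → InputRule}

theorem primrec_input_rules (hx : Primrec x) : Primrec fun y => (x y).2.1 :=
  Primrec.fst.comp (Primrec.snd.comp hx)

theorem primrec_input_target (hx : Primrec x) : Primrec fun y => (x y).2.2.1 :=
  Primrec.fst.comp (Primrec.snd.comp (Primrec.snd.comp hx))

theorem primrec_input_initial (hx : Primrec x) : Primrec fun y => (x y).2.2.2 :=
  Primrec.snd.comp (Primrec.snd.comp (Primrec.snd.comp hx))

theorem primrecPred_exists_listLE (hx : Primrec x) (hk : Primrec k) (ha : Primrec a) :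
    PrimrecPred fun y => ∃ κ ∈ k y, ListLE (x y).1 κ (a y) :=
  PrimrecPred.exists_mem hk (p := fun y κ => ListLE (x y).1 κ (a y))
    (primrecPred_listLE (n := fun z : α × List ℕ => (x z.1).1)
      ((Primrec.fst.comp hx).comp Primrec.fst) Primrec.snd (ha.comp Primrec.fst))

theorem primrecPred_exists_ranked_le (hx : Primrec x) (hc : Primrec c) (ha : Primrec a) :
    PrimrecPred fun y => ∃ g ∈ c y, ListLE (x y).1 g.1 (a y) :=
  PrimrecPred.exists_mem hc (p := fun y g => ListLE (x y).1 g.1 (a y))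
    (primrecPred_listLE (n := fun z : α × List ℕ × ℕ => (x z.1).1)
      ((Primrec.fst.comp hx).comp Primrec.fst) (Primrec.fst.comp Primrec.snd)
      (ha.comp Primrec.fst))

theorem primrecPred_exists_le_ranked (hx : Primrec x) (hc : Primrec c) (ha : Primrec a) :
    PrimrecPred fun y => ∃ g ∈ c y, ListLE (x y).1 (a y) g.1 :=
  PrimrecPred.exists_mem hc (p := fun y g => ListLE (x y).1 (a y) g.1)
    (primrecPred_listLE (n := fun z : α × List ℕ × ℕ => (x z.1).1)
      ((Primrec.fst.comp hx).comp Primrec.fst) (ha.comp Primrec.fst)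
      (Primrec.fst.comp Primrec.snd))

theorem primrecPred_lt (hx : Primrec x) (hq : Primrec q) :
    PrimrecPred fun y => (q y).1 < (x y).1 :=
  Primrec.nat_lt.comp (Primrec.fst.comp hq) (Primrec.fst.comp hx)

/-- Guarding the application of some rule and the descent to some ranked configuration. -/
theorem primrecPred_exists_step {p : α → List ℕ → List ℕ → Prop} (hx : Primrec x)
    (hc : Primrec c) (hg : Primrec g)
    (hp : PrimrecPred fun z : α × List ℕ × List ℕ => p z.1 z.2.1 z.2.2) :
    PrimrecPred fun y => ∃ q ∈ (x y).2.1, q.1 < (x y).1 ∧ 1 ≤ (g y).1.getD q.1 0 ∧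
      ∃ g' ∈ c y, g'.2 < (g y).2 ∧ p y g'.1 (applyList (x y).1 (g y).1 q) := by
  have h1 : PrimrecPred fun z : (α × InputRule) × List ℕ × ℕ =>
      z.2.2 < (g z.1.1).2 ∧ p z.1.1 z.2.1 (applyList (x z.1.1).1 (g z.1.1).1 z.1.2) := by
    have hα : Primrec fun z : (α × InputRule) × List ℕ × ℕ => z.1.1 :=
      Primrec.fst.comp Primrec.fst
    have happ : Primrec fun z : (α × InputRule) × List ℕ × ℕ =>
        applyList (x z.1.1).1 (g z.1.1).1 z.1.2 :=
      primrec_applyList ((Primrec.fst.comp hx).comp hα) ((Primrec.fst.comp hg).comp hα)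
        (Primrec.snd.comp Primrec.fst)
    exact .and (Primrec.nat_lt.comp (Primrec.snd.comp Primrec.snd) ((Primrec.snd.comp hg).comp hα))
      (hp.comp (hα.pair ((Primrec.fst.comp Primrec.snd).pair happ)))
  have h2 : PrimrecPred fun z : α × InputRule => 1 ≤ (g z.1).1.getD z.2.1 0 :=
    Primrec.nat_le.comp (Primrec.const 1) ((Primrec.list_getD 0).comp
      ((Primrec.fst.comp hg).comp Primrec.fst) (Primrec.fst.comp Primrec.snd))
  exact PrimrecPred.exists_mem (primrec_input_rules hx)
    (.and (primrecPred_lt (hx.comp Primrec.fst) Primrec.snd)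
      (.and h2 (PrimrecPred.exists_mem (hc.comp Primrec.fst) h1)))

theorem primrecPred_closed (hx : Primrec x) (hc : Primrec c) (ha : Primrec a) :
    PrimrecPred fun y => ∀ q ∈ (x y).2.1, q.1 < (x y).1 →
      (∃ φ ∈ (x y).2.2.1, ListLE (x y).1 φ (enableList (x y).1 (a y) q)) ∨
        ∃ g' ∈ c y, ListLE (x y).1 g'.1 (applyList (x y).1 (enableList (x y).1 (a y) q) q) := by
  have hx' : Primrec fun z : α × InputRule => x z.1 := hx.comp Primrec.fst
  have hn : Primrec fun z : α × InputRule => (x z.1).1 := Primrec.fst.comp hx'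
  have hen : Primrec fun z : α × InputRule => enableList (x z.1).1 (a z.1) z.2 :=
    primrec_enableList hn (ha.comp Primrec.fst) Primrec.snd
  exact PrimrecPred.forall_mem (primrec_input_rules hx)
    (.imp (primrecPred_lt hx' Primrec.snd)
      (.or (primrecPred_exists_listLE hx' (primrec_input_target hx') hen)
        (primrecPred_exists_ranked_le hx' (hc.comp Primrec.fst)
          (primrec_applyList hn hen Primrec.snd))))

theorem primrecPred_pre (hx : Primrec x) (hk : Primrec k) (ha : Primrec a) :
    PrimrecPred fun y => ∀ q ∈ (x y).2.1, q.1 < (x y).1 →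
      ∃ κ' ∈ k y, ListLE (x y).1 κ' (preList (x y).1 (a y) q) := by
  have hx' : Primrec fun z : α × InputRule => x z.1 := hx.comp Primrec.fst
  exact PrimrecPred.forall_mem (primrec_input_rules hx)
    (.imp (primrecPred_lt hx' Primrec.snd)
      (primrecPred_exists_listLE hx' (hk.comp Primrec.fst)
        (primrec_preList (Primrec.fst.comp hx') (ha.comp Primrec.fst) Primrec.snd)))

theorem primrecPred_reach_ranks (hx : Primrec x) (hc : Primrec c) :
    PrimrecPred fun y => ∀ g ∈ c y, (∃ φ ∈ (x y).2.2.1, ListLE (x y).1 φ g.1) ∨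
      ∃ q ∈ (x y).2.1, q.1 < (x y).1 ∧ 1 ≤ g.1.getD q.1 0 ∧
        ∃ g' ∈ c y, g'.2 < g.2 ∧ ListLE (x y).1 g'.1 (applyList (x y).1 g.1 q) := by
  have hx' : Primrec fun z : α × List ℕ × ℕ => x z.1 := hx.comp Primrec.fst
  have hc' : Primrec fun z : α × List ℕ × ℕ => c z.1 := hc.comp Primrec.fst
  have hstep := primrecPred_exists_step (p := fun z b b' => ListLE (x z.1).1 b b') hx' hc'
    Primrec.snd (primrecPred_listLE ((Primrec.fst.comp hx').comp Primrec.fst)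
      (Primrec.fst.comp Primrec.snd) (Primrec.snd.comp Primrec.snd))
  exact PrimrecPred.forall_mem hc ((primrecPred_exists_listLE hx' (primrec_input_target hx')
    (Primrec.fst.comp Primrec.snd)).or hstep)

theorem primrecPred_escape_ranks (hx : Primrec x) (hc : Primrec c) (hk : Primrec k) :
    PrimrecPred fun y => ∀ g ∈ c y, (¬ ∃ φ ∈ (x y).2.2.1, ListLE (x y).1 φ g.1) ∧
      ((¬ ∃ κ ∈ k y, ListLE (x y).1 κ g.1) ∨
      ∃ q ∈ (x y).2.1, q.1 < (x y).1 ∧ 1 ≤ g.1.getD q.1 0 ∧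
        ∃ g' ∈ c y, g'.2 < g.2 ∧ ListLE (x y).1 (applyList (x y).1 g.1 q) g'.1) := by
  have hx' : Primrec fun z : α × List ℕ × ℕ => x z.1 := hx.comp Primrec.fst
  have hc' : Primrec fun z : α × List ℕ × ℕ => c z.1 := hc.comp Primrec.fst
  have hg : Primrec fun z : α × List ℕ × ℕ => z.2.1 := Primrec.fst.comp Primrec.snd
  have hstep := primrecPred_exists_step (p := fun z b b' => ListLE (x z.1).1 b' b) hx' hc'
    Primrec.snd (primrecPred_listLE ((Primrec.fst.comp hx').comp Primrec.fst)
      (Primrec.snd.comp Primrec.snd) (Primrec.fst.comp Primrec.snd))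
  exact PrimrecPred.forall_mem hc
    ((primrecPred_exists_listLE hx' (primrec_input_target hx') hg).not.and
      ((primrecPred_exists_listLE hx' (hk.comp Primrec.fst) hg).not.or hstep))

theorem primrecPred_reachCheck {c : α → Cert} (hx : Primrec x) (hc : Primrec c) :
    PrimrecPred fun y => ReachCheck (x y) (c y) := by
  have hc₁ : Primrec fun y => (c y).1 := Primrec.fst.comp hc
  exact .and (primrecPred_exists_ranked_le hx hc₁ (primrec_input_initial hx))
    (.and (PrimrecPred.forall_mem hc₁ (primrecPred_closed (hx.comp Primrec.fst)
        (hc₁.comp Primrec.fst) (Primrec.fst.comp Primrec.snd)))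
      (primrecPred_reach_ranks hx hc₁))

theorem primrecPred_escapeCheck {c : α → Cert} (hx : Primrec x) (hc : Primrec c) :
    PrimrecPred fun y => EscapeCheck (x y) (c y) := by
  have hc₁ : Primrec fun y => (c y).1 := Primrec.fst.comp hc
  have hc₂ : Primrec fun y => (c y).2 := Primrec.snd.comp hc
  exact .and (primrecPred_exists_le_ranked hx hc₁ (primrec_input_initial hx))
    (.and (primrecPred_escape_ranks hx hc₁ hc₂)
      (.and (PrimrecPred.forall_mem (primrec_input_target hx)
          (primrecPred_exists_listLE (hx.comp Primrec.fst) (hc₂.comp Primrec.fst) Primrec.snd))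
        (PrimrecPred.forall_mem hc₂
          (primrecPred_pre (hx.comp Primrec.fst) (hc₂.comp Primrec.fst) Primrec.snd))))

end

/-! ### The decision procedure and its correctness -/

/-- The certificates require only a finite list of rules, with no condition on probabilities. Hence
the search terminates on every input, including those that present no pBPP. -/
theorem exists_computable_not_canEscape :
    ∃ f : Input → Bool, Computable f ∧ ∀ x : Input, f x = true ↔
      ¬ CanEscape (rulesOf x.1 x.2.1) (targetOf x.1 x.2.2.1) (ofList x.1 x.2.2.2) := by
  have hreach : ∀ x : Input, (∃ c, ReachCheck x c) ↔
      ¬ CanEscape (rulesOf x.1 x.2.1) (targetOf x.1 x.2.2.1) (ofList x.1 x.2.2.2) := by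
    refine fun x => ⟨fun ⟨c, hc⟩ => ?_, fun h => ?_⟩
    · exact ((reachCheck_iff x c).1 hc).not_canEscape (isUpperSet_targetOf _ _)
    · obtain ⟨C, hC, h⟩ := exists_isReachCert (isUpperSet_targetOf _ _) h
      obtain ⟨l, rfl⟩ := exists_rankedOf_eq hC
      -- Certificates of both kinds share one type; this kind ignores the second component.
      exact ⟨(l, []), (reachCheck_iff x (l, [])).2 h⟩
  have hescape : ∀ x : Input, (∃ c, EscapeCheck x c) ↔
      CanEscape (rulesOf x.1 x.2.1) (targetOf x.1 x.2.2.1) (ofList x.1 x.2.2.2) := by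
    refine fun x => ⟨fun ⟨c, hc⟩ => ?_, fun h => ?_⟩
    · exact ((escapeCheck_iff x c).1 hc).canEscape (isUpperSet_targetOf _ _)
    · obtain ⟨C, K, hC, hK, h⟩ := exists_isEscapeCert (isUpperSet_targetOf _ _) h
      obtain ⟨l, rfl⟩ := exists_rankedOf_eq hC
      obtain ⟨k, rfl⟩ := exists_configsOf_eq hK
      exact ⟨(l, k), (escapeCheck_iff x (l, k)).2 h⟩
  obtain ⟨f, hf, h⟩ := exists_computable_of_certificates
    (primrecPred_reachCheck Primrec.fst Primrec.snd)
    (primrecPred_escapeCheck Primrec.fst Primrec.snd)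
    (fun x => by rw [hreach, hescape]; exact id)
    (fun x => by rw [hreach, hescape]; exact (em _).symm)
  exact ⟨f, hf, fun x => (h x).trans (hreach x)⟩

theorem rulesOf_encodeInput {n : ℕ} {S : PBPP (Fin n)} {L : List (Fin n × (Fin n → ℕ))}
    (hL : ∀ r, r ∈ L ↔ r ∈ S.rules) (φs : List (Fin n → ℕ)) (α₀ : Fin n → ℕ) :
    rulesOf n (encodeInput S L φs α₀).2.1 = S.rules := by
  ext r
  simp only [rulesOf, encodeInput, ruleOf, List.mem_map, Set.mem_ofPred_eq, Finset.mem_coe, ← hL]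
  constructor
  · rintro ⟨_, ⟨r', hr', rfl⟩, _, rfl⟩
    simpa [ofList_ofFn] using hr'
  · exact fun hr => ⟨_, ⟨r, hr, rfl⟩, r.1.2, by simp [ofList_ofFn]⟩

theorem targetOf_encodeInput {n : ℕ} (S : PBPP (Fin n)) (L : List (Fin n × (Fin n → ℕ)))
    (φs : List (Fin n → ℕ)) (α₀ : Fin n → ℕ) :
    targetOf n (encodeInput S L φs α₀).2.2.1 = {β | ∃ φ ∈ φs, φ ≤ β} := by
  ext β
  simp [targetOf, encodeInput, ofList_ofFn]

end PBPP

theorem mainTheorem1 :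
    (∃ f : PBPP.Input → Bool, Computable f ∧
      ∀ (n : ℕ) (S : PBPP (Fin n)) (L : List (Fin n × (Fin n → ℕ))),
        (∀ r, r ∈ L ↔ r ∈ S.rules) →
        ∀ (F : Set (Fin n → ℕ)) (φs : List (Fin n → ℕ)),
          F = {β | ∃ φ ∈ φs, φ ≤ β} →
          ∀ α₀ : Fin n → ℕ,
            f (PBPP.encodeInput S L φs α₀) = true ↔ S.chainType.probReach α₀ F = 1) ∧
    (∃ f : PBPP.Input → Bool, Computable f ∧
      ∀ (n : ℕ) (S : PBPP (Fin n)) (L : List (Fin n × (Fin n → ℕ))),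
        (∀ r, r ∈ L ↔ r ∈ S.rules) →
        ∀ (F : Set (Fin n → ℕ)) (φs : List (Fin n → ℕ)),
          F = {β | ∃ φ ∈ φs, φ ≤ β} →
          ∀ α₀ : Fin n → ℕ,
            f (PBPP.encodeInput S L φs α₀) = true ↔ S.chainProc.probReach α₀ F = 1) := by
  obtain ⟨f, hf, h⟩ := PBPP.exists_computable_not_canEscape
  have key : ∀ (n : ℕ) (S : PBPP (Fin n)) (L : List (Fin n × (Fin n → ℕ))),
      (∀ r, r ∈ L ↔ r ∈ S.rules) →
      ∀ (F : Set (Fin n → ℕ)) (φs : List (Fin n → ℕ)), F = {β | ∃ φ ∈ φs, φ ≤ β} →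
      ∀ α₀ : Fin n → ℕ, IsUpperSet F ∧ (f (PBPP.encodeInput S L φs α₀) = true ↔
        ¬ PBPP.CanEscape (S.rules : Set (Fin n × (Fin n → ℕ))) F α₀) := by
    rintro n S L hL F φs rfl α₀
    refine ⟨fun _ _ hle ⟨φ, hφ, h⟩ => ⟨φ, hφ, h.trans hle⟩, ?_⟩
    have hα : PBPP.ofList n (PBPP.encodeInput S L φs α₀).2.2.2 = α₀ := PBPP.ofList_ofFn α₀
    rw [h, ← PBPP.rulesOf_encodeInput hL φs α₀, ← PBPP.targetOf_encodeInput S L φs α₀]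
    conv_rhs => rw [← hα]
    rfl
  refine ⟨⟨f, hf, fun n S L hL F φs hF α₀ => ?_⟩, f, hf, fun n S L hL F φs hF α₀ => ?_⟩
  · obtain ⟨hup, h⟩ := key n S L hL F φs hF α₀
    rw [h, S.probReach_chainType_eq_one_iff hup]
  · obtain ⟨hup, h⟩ := key n S L hL F φs hF α₀
    rw [h, S.probReach_chainProc_eq_one_iff hup]
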